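/- Let $H$ be a finite graph with chromatic number $\chi(H)=r\ge 2$ and let $h:=|H|$ be its number of vertices. Let $\sigma:=\sigma(H)$ be the size of the smallest possible colour class in any $r$-colouring of $H$, let $\chi_{cr}(H):=(r-1)\frac{h}{h-\sigma}$, and for $x\in(0,1)$ let \[g_H(x):=x\left(1-\frac1{\chi_{cr}(H)}\right)+(1-x)\left(1-\frac1{r-1}\right).\] Then for every $x\in(0,1)$ and every $\eta>0$ there exists $n_0=n_0(\eta,x,H)\in\mathbb N$ such that the following holds. Suppose $G$ is a graph on $n\ge n_0$ vertices with degree sequence $d_1\le d_2\le\dots\le d_n$ such that \[d_i\ge\left(g_H(x)-\frac{x\sigma}{h}\right)n+\frac{(r-1)x\sigma}{h-x\sigma}\,i\qquad\text{for all } 1\le i\le\frac{h-x\sigma}{(r-1)h}\,n.\] Then $G$ contains an $H$-tiling (a collection of pairwise vertex-disjoint, not necessarily induced, copies of $H$ in $G$) covering at least $(x-\eta)n$ vertices of $G$. -/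

import Mathlib

universe u v

namespace SimpleGraph

/-- The chromatic number as a natural number (used for finite graphs only, where it is finite). -/
noncomputable def chi {W : Type*} (H : SimpleGraph W) : ℕ :=
  H.chromaticNumber.toNat

/-- `σ(H)`: the size of the smallest possible colour class in any `χ(H)`-colouring of `H`. -/
noncomputable def smallestClass {W : Type*} (H : SimpleGraph W) : ℕ :=
  sInf {k : ℕ | ∃ (C : H.Coloring (Fin H.chi)) (c : Fin H.chi), k = (C.colorClass c).ncard}

/-- The critical chromatic number `χ_cr(H) = (χ(H) - 1) |H| / (|H| - σ(H))`. -/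
noncomputable def chiCr {W : Type*} [Fintype W] (H : SimpleGraph W) : ℝ :=
  ((H.chi : ℝ) - 1) * (Fintype.card W : ℝ) / ((Fintype.card W : ℝ) - (H.smallestClass : ℝ))

/-- `g_H(x) = x (1 - 1/χ_cr(H)) + (1 - x) (1 - 1/(χ(H) - 1))`. -/
noncomputable def komlosThreshold {W : Type*} [Fintype W] (H : SimpleGraph W) (x : ℝ) : ℝ :=
  x * (1 - 1 / H.chiCr) + (1 - x) * (1 - 1 / ((H.chi : ℝ) - 1))

/-- `d` is the degree sequence `d 0 ≤ d 1 ≤ ... ≤ d (n - 1)` of the `n`-vertex graph `G`, that is,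
the degrees of all the vertices, listed in non-decreasing order (indices start at `0`). -/
def IsDegreeSequence {V : Type*} [Fintype V] (G : SimpleGraph V) [DecidableRel G.Adj]
    {n : ℕ} (d : Fin n → ℕ) : Prop :=
  Monotone d ∧ ∃ e : Fin n ≃ V, ∀ i, d i = G.degree (e i)

/-- An `H`-tiling in `G`: a collection of pairwise vertex-disjoint copies of `H` in `G`, a copy of
`H` being a (not necessarily induced) subgraph of `G` that is isomorphic to `H`. -/
def IsTiling {W V : Type*} (H : SimpleGraph W) (G : SimpleGraph V) (T : Set G.Subgraph) : Prop :=
  (∀ S ∈ T, Nonempty (H ≃g S.coe)) ∧ T.PairwiseDisjoint Subgraph.verts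

/-- The set of vertices of `G` covered by a collection of subgraphs of `G`. -/
def coveredVerts {V : Type*} {G : SimpleGraph V} (T : Set G.Subgraph) : Set V :=
  ⋃ S ∈ T, S.verts

end SimpleGraph

namespace SimpleGraph

open Finset

/-! Write `s = r - 1`, `a = xσ/h` and `b = (h - xσ)/(sh)`, so that `a + s b = 1` and, since `x < 1`,
`a < b`. A direct computation gives `g_H(x) = 1 - b`, so the hypothesis reads `d_i ≥ (1 - a - b) n +
(a/b) i` for `i ≤ b n`. Up to an additive constant this says that every nonempty vertex set `S`
contains a vertex of degree at least `(1 - a - b) n + (a/b) min(|S|, b n)`. In this form the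
condition passes to the reduced graph of a regular partition (`reducedGraph_degree_property`).

The core is `exists_fractional_tiling`: such a graph has an almost perfect fractional tiling by
ordered `(s+1)`-cliques that put weight `a` on one vertex, the neck, and `b` on each other one.
Entries may at first be jokers, adjacent to everything. If the constant load `t` is on the boundary
of the polytope of attainable loads, a supporting hyperplane gives values `m`, nonnegative in
weighted sum over every clique and of sum zero on the cliques in use. Let `x` be a vertex of minimal
value, chosen among all minimisers `Z` with few nonneighbours. Inserting `x` into a tight clique
cannot decrease its sum, so `x` has nonneighbours of weight at least `b` in it, and of weight `a +
b` unless the clique puts weight at least `b` on `Z` (`nonneighbour_load_of_tight`). Averaging over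
the tiling and comparing with the degree of `x` shows that `t` is nearly `1/|V|`. Jokers then carry
little weight, and cliques containing one can be dropped.

Finally each weighted clique of clusters is filled with copies of `H`: the smallest colour class
goes to the neck and the other `s` classes are rotated over the remaining clusters. This respects
the loads `a` and `b` and covers an `x` fraction of the weight
(`exists_tiling_of_fractional_tiling`). The copies come from greedy embedding into uniform dense
pairs. -/

/-- The weights of the classes of a bottle: the neck `o` has weight `a`, the others weight `b`. -/
noncomputable def bottleWeight {J : Type*} [DecidableEq J] (o : J) (a b : ℝ) (j : J) : ℝ :=
  if j = o then a else b

/-- An ordered clique of `G` some of whose entries may be jokers (`none`). -/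
def IsJokerClique {V J : Type*} (G : SimpleGraph V) (c : J → Option V) : Prop :=
  ∀ i j, i ≠ j → ∀ u ∈ c i, ∀ v ∈ c j, G.Adj u v

/-- The weight that an ordered clique with jokers puts on the vertex `v`. -/
noncomputable def jokerLoad {V J : Type*} [Fintype J] [DecidableEq V] (w : J → ℝ)
    (c : J → Option V) (v : V) : ℝ :=
  ∑ j, if c j = some v then w j else 0

/-! ### Weighted cliques with jokers and the exchange argument -/

section Weights

variable {V J : Type*}

lemma bottleWeight_self [DecidableEq J] (o : J) (a b : ℝ) : bottleWeight o a b o = a := by simp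
    [bottleWeight]

lemma bottleWeight_of_ne [DecidableEq J] {o j : J} (a b : ℝ)
    (h : j ≠ o) : bottleWeight o a b j = b := by
  simp [bottleWeight, h]

lemma bottleWeight_pos [DecidableEq J] {a b : ℝ} (ha : 0 < a) (hb : 0 < b) (o j : J) :
    0 < bottleWeight o a b j := by
  unfold bottleWeight; split_ifs <;> assumption

lemma le_bottleWeight [DecidableEq J] {a b : ℝ} (hab : a ≤ b)
    (o j : J) : a ≤ bottleWeight o a b j := by
  unfold bottleWeight; split_ifs
  · exact le_rfl
  · exact hab

lemma jokerLoad_nonneg [Fintype J] [DecidableEq V] {w : J → ℝ} (hw : ∀ j, 0 ≤ w j)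
    (c : J → Option V) (v : V) :
    0 ≤ jokerLoad w c v :=
  sum_nonneg fun j _ => by split_ifs <;> simp [hw]

lemma sum_jokerLoad_mul [Fintype J] [DecidableEq V] [Fintype V] (w : J → ℝ) (c : J → Option V)
    (g : V → ℝ) :
    ∑ v, jokerLoad w c v * g v = ∑ j, w j * (c j).elim 0 g := by
  simp only [jokerLoad, sum_mul]
  rw [sum_comm]
  refine sum_congr rfl fun j _ => ?_
  cases h : c j with
  | none => simp
  | some u => simp [ite_mul]

lemma sum_update_mul [Fintype J] [DecidableEq J] (w : J → ℝ) {α : Type*} (c : J → α) (j : J)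
    (p : α) (m : α → ℝ) :
    ∑ i, w i * m (Function.update c j p i) = ∑ i, w i * m (c i) + w j * (m p - m (c j)) := by
  rw [← add_sum_erase _ _ (mem_univ j), ← add_sum_erase _ (fun i => w i * m (c i)) (mem_univ j)]
  have : ∑ i ∈ univ.erase j, w i * m (Function.update c j p i)
      = ∑ i ∈ univ.erase j, w i * m (c i) :=
    sum_congr rfl fun i hi => by rw [Function.update_of_ne (ne_of_mem_erase hi)]
  rw [this, Function.update_self]
  ring

lemma IsJokerClique.update [DecidableEq J] {G : SimpleGraph V} {c : J → Option V}
    (hc : G.IsJokerClique c) {j : J}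
    {p : Option V} (h : ∀ i, i ≠ j → ∀ u ∈ p, ∀ v ∈ c i, G.Adj u v) :
    G.IsJokerClique (Function.update c j p) := by
  intro i k hik u hu v hv
  by_cases hi : i = j
  · subst hi
    rw [Function.update_self] at hu
    rw [Function.update_of_ne hik.symm] at hv
    exact h k hik.symm u hu v hv
  · rw [Function.update_of_ne hi] at hu
    by_cases hk : k = j
    · subst hk
      rw [Function.update_self] at hv
      exact (h i hi v hv u hu).symm
    · rw [Function.update_of_ne hk] at hv
      exact hc i k hik u hu v hv

/-- Given a dual solution `m` that is tight at the clique `c`, a vertex `x` of minimal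
(negative) value has many nonneighbours in `c`. -/
lemma nonneighbour_load_of_tight [Fintype J] [DecidableEq J] {G : SimpleGraph V}
    [DecidableRel G.Adj] {o : J} {a b : ℝ}
    (ha : 0 < a) (hab : a < b) (hsum : ∑ j, bottleWeight o a b j = 1) (hJ : ∃ j, j ≠ o)
    {m : Option V → ℝ}
    (hm : ∀ c, G.IsJokerClique c → 0 ≤ ∑ j, bottleWeight o a b j * m (c j))
    {x : V} (hmin : ∀ p, m (some x) ≤ m p) (hneg : m (some x) < 0)
    {c : J → Option V} (hc : G.IsJokerClique c)
    (htight : ∑ j, bottleWeight o a b j * m (c j) = 0) :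
    b ≤ ∑ j, bottleWeight o a b j * (c j).elim 0 (fun u => if G.Adj x u then 0 else 1) ∧
    a + b ≤ ∑ j, bottleWeight o a b j * (c j).elim 0 (fun u => if G.Adj x u then 0 else 1) +
      a / b * ∑ j, bottleWeight o a b j *
        (c j).elim 0 (fun u => if m (some u) = m (some x) then 1 else 0) := by
  have hb : 0 < b := ha.trans hab
  set w := bottleWeight o a b with hw
  have hwpos : ∀ j, 0 < w j := bottleWeight_pos ha hb o
  set nl : J → ℝ := fun j => (c j).elim 0 (fun u => if G.Adj x u then 0 else 1) with hnl
  set zl : J → ℝ := fun j => (c j).elim 0 (fun u => if m (some u) = m (some x) then 1 else 0)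
    with hzl
  have hnl0 : ∀ j, 0 ≤ w j * nl j := fun j => by
    refine mul_nonneg (hwpos j).le ?_
    simp only [hnl]; cases c j <;> simp; split_ifs <;> norm_num
  have hzl0 : ∀ j, 0 ≤ w j * zl j := fun j => by
    refine mul_nonneg (hwpos j).le ?_
    simp only [hzl]; cases c j <;> simp; split_ifs <;> norm_num
  have hnl1 : ∀ j, (∃ u ∈ c j, ¬G.Adj x u) → nl j = 1 := by
    rintro j ⟨u, hu, hxu⟩
    simp only [hnl, Option.mem_def.1 hu]; simp [hxu]
  -- Otherwise `x` is adjacent to all entries outside the neck. Moving `c j` to the neck, discarding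
  -- `c o`, and putting `x` at `j` changes the sum by `a (m (c j) - m (c o)) + b (m x - m (c j))`.
  -- As `a < b` and `m x` is minimal, this is nonnegative only if the three values agree. Then all
  -- entries have the same negative value, against tightness.
  obtain ⟨j, hjo, hj⟩ : ∃ j, j ≠ o ∧ ∃ u ∈ c j, ¬G.Adj x u := by
    by_contra! hcon
    have key : ∀ j, j ≠ o → m (c j) = m (some x) ∧ m (c o) = m (some x) := by
      intro j hj
      have h2 : G.IsJokerClique (Function.update (Function.update c o (c j)) j (some x)) := by
        intro i k hik u hu v hv
        have aux : ∀ i, i ≠ j → ∀ u ∈ Function.update (Function.update c o (c j)) j (some x) i,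
            G.Adj x u := by
          intro i hi u hu
          rw [Function.update_of_ne hi] at hu
          by_cases hio : i = o
          · subst hio; rw [Function.update_self] at hu; exact hcon j hj u hu
          · rw [Function.update_of_ne hio] at hu; exact hcon i hio u hu
        by_cases hi : i = j
        · subst hi
          rw [Function.update_self, Option.mem_some_iff] at hu
          subst hu
          exact aux k hik.symm v hv
        · by_cases hk : k = j
          · subst hk
            rw [Function.update_self, Option.mem_some_iff] at hv
            subst hv
            exact (aux i hi u hu).symm
          · rw [Function.update_of_ne hi] at hu
            rw [Function.update_of_ne hk] at hv
            by_cases hio : i = o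
            · subst hio
              rw [Function.update_self] at hu
              rw [Function.update_of_ne hik.symm] at hv
              exact hc j k (Ne.symm hk) u hu v hv
            · rw [Function.update_of_ne hio] at hu
              by_cases hko : k = o
              · subst hko
                rw [Function.update_self] at hv
                exact hc i j hi u hu v hv
              · rw [Function.update_of_ne hko] at hv
                exact hc i k hik u hu v hv
      have h3 := hm _ h2
      rw [sum_update_mul, sum_update_mul, htight, Function.update_of_ne hj, hw,
        bottleWeight_self, bottleWeight_of_ne _ _ hj] at h3
      have e1 := hmin (c j)
      have e2 := hmin (c o)
      have e3 : m (c j) = m (some x) := by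
        refine le_antisymm ?_ e1
        by_contra! hlt
        nlinarith [mul_pos (sub_pos.2 hab) (sub_pos.2 hlt), mul_nonneg ha.le (sub_nonneg.2 e2)]
      refine ⟨e3, le_antisymm ?_ e2⟩
      rw [e3] at h3
      by_contra! hlt
      nlinarith [mul_pos ha (sub_pos.2 hlt)]
    obtain ⟨j₀, hj₀⟩ := hJ
    have hall : ∀ j, m (c j) = m (some x) := fun j => by
      by_cases h : j = o
      · rw [h]; exact (key j₀ hj₀).2
      · exact (key j h).1
    simp only [hall] at htight
    rw [← sum_mul, hsum] at htight
    linarith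
  have hwj : w j = b := bottleWeight_of_ne _ _ hjo
  have hle1 : b ≤ ∑ j, w j * nl j := by
    calc b = w j * nl j := by rw [hnl1 j hj, hwj, mul_one]
      _ ≤ _ := single_le_sum (fun i _ => hnl0 i) (mem_univ j)
  refine ⟨hle1, ?_⟩
  -- Two nonneighbours weigh at least `a + b`. If the one at `j` is the only one, it can be
  -- exchanged for `x`, and tightness forces it to be a minimiser too; its weight `b`, scaled by `a
  -- / b`, supplies the missing `a`.
  by_cases hex : ∃ k, k ≠ j ∧ ∃ u ∈ c k, ¬G.Adj x u
  · obtain ⟨k, hkj, hk⟩ := hex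
    have h1 : a + b ≤ ∑ j, w j * nl j := by
      calc a + b ≤ w k * nl k + w j * nl j := by
            rw [hnl1 j hj, hnl1 k hk, hwj, mul_one, mul_one]
            linarith [le_bottleWeight hab.le o k]
        _ = ∑ i ∈ {k, j}, w i * nl i := (sum_pair (f := fun i => w i * nl i) hkj).symm
        _ ≤ _ := sum_le_sum_of_subset_of_nonneg (subset_univ _) fun i _ _ => hnl0 i
    have h2 : 0 ≤ a / b * ∑ j, w j * zl j :=
      mul_nonneg (div_nonneg ha.le hb.le) (sum_nonneg fun i _ => hzl0 i)
    linarith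
  · push Not at hex
    have h2 : G.IsJokerClique (Function.update c j (some x)) := by
      refine hc.update fun i hi u hu v hv => ?_
      rw [Option.mem_some_iff] at hu
      subst hu
      exact hex i hi v hv
    have h3 := hm _ h2
    rw [sum_update_mul, htight, hwj, zero_add] at h3
    have h4 : m (c j) = m (some x) := by
      refine le_antisymm ?_ (hmin _)
      have := nonneg_of_mul_nonneg_right h3 hb
      linarith
    have h5 : zl j = 1 := by
      simp only [hzl]
      obtain ⟨u, hu, -⟩ := hj
      rw [Option.mem_def.1 hu] at h4 ⊢
      simp [h4]
    have h6 : b ≤ ∑ j, w j * zl j := by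
      calc b = w j * zl j := by rw [h5, hwj, mul_one]
        _ ≤ _ := single_le_sum (fun i _ => hzl0 i) (mem_univ j)
    have h7 : a ≤ a / b * ∑ j, w j * zl j := by
      calc a = a / b * b := by field_simp
        _ ≤ _ := by gcongr
    linarith

end Weights

/-! ### The polytope of attainable loads -/

open scoped Classical in
/-- The weight distributions of fractional tilings by ordered cliques with jokers. -/
noncomputable def jokerPolytope {V J : Type*} [Fintype V] [Fintype J] (G : SimpleGraph V)
    (w : J → ℝ) : Set (V → ℝ) :=
  (fun (p : {c : J → Option V // G.IsJokerClique c} → ℝ) v => ∑ c, p c * jokerLoad w c.1 v) ''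
    stdSimplex ℝ {c : J → Option V // G.IsJokerClique c}

section Polytope

variable {V J : Type*} [Fintype V] [Fintype J] {G : SimpleGraph V} {w : J → ℝ}

lemma exists_of_mem_jokerPolytope [DecidableEq V]
    [Fintype {c : J → Option V // G.IsJokerClique c}] {q : V → ℝ} (hq : q ∈ G.jokerPolytope w) :
    ∃ p : {c : J → Option V // G.IsJokerClique c} → ℝ, (∀ c, 0 ≤ p c) ∧ ∑ c, p c = 1 ∧
      ∀ v, ∑ c, p c * jokerLoad w c.1 v = q v := by
  obtain ⟨p, ⟨h0, h1⟩, rfl⟩ := hq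
  refine ⟨p, h0, ?_, fun v => ?_⟩
  · convert h1
  · beta_reduce
    congr!

lemma isCompact_jokerPolytope : IsCompact (G.jokerPolytope w) := by
  classical
  exact (isCompact_stdSimplex _ _).image (by fun_prop)

lemma convex_jokerPolytope : Convex ℝ (G.jokerPolytope w) := by
  classical
  refine (convex_stdSimplex ℝ _).is_linear_image ⟨fun p q => ?_, fun t p => ?_⟩
  · ext v; simp [add_mul, sum_add_distrib]
  · ext v; simp [mul_sum, mul_assoc]

lemma jokerLoad_mem_jokerPolytope [DecidableEq V] {c : J → Option V} (hc : G.IsJokerClique c) :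
    jokerLoad w c ∈ G.jokerPolytope w := by
  classical
  refine ⟨Pi.single ⟨c, hc⟩ 1, single_mem_stdSimplex ℝ _, ?_⟩
  ext v
  beta_reduce
  rw [sum_eq_single ⟨c, hc⟩]
  · simp only [Pi.single_eq_same, one_mul, jokerLoad]
    congr!
  · intro d _ hd; simp [hd]
  · simp

lemma zero_mem_jokerPolytope : (0 : V → ℝ) ∈ G.jokerPolytope w := by
  classical
  have h : G.IsJokerClique (fun _ : J => none) := by simp [IsJokerClique]
  convert jokerLoad_mem_jokerPolytope (w := w) h
  ext v; simp [jokerLoad]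

/-- Cliques with a single vertex, at position `j`, and jokers elsewhere realise the multiples `w j`
of the unit vectors; the rest follows by convexity with the all-joker clique. This gives the
polytope a nonempty interior and a positive constant point. -/
lemma mem_jokerPolytope_of_sum_le {j : J} (hj : 0 < w j) {q : V → ℝ} (hq : ∀ v, 0 ≤ q v)
    (hsum : ∑ v, q v ≤ w j) : q ∈ G.jokerPolytope w := by
  classical
  have hbot : ∀ v, Pi.single v (w j) ∈ G.jokerPolytope w := by
    intro v
    have h : G.IsJokerClique (Function.update (fun _ : J => none) j (some v)) := by
      intro i k hik u hu v' hv'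
      by_cases hi : i = j
      · have hk : k ≠ j := fun h => hik (hi.trans h.symm)
        simp [hk] at hv'
      · simp [hi] at hu
    convert jokerLoad_mem_jokerPolytope (w := w) h
    ext u
    rw [jokerLoad, sum_eq_single j]
    · simp [Pi.single_apply, eq_comm]
    · intro i _ hi; simp [hi]
    · simp
  have := convex_jokerPolytope (G := G) (w := w) |>.sum_mem (t := (univ : Finset (Option V)))
    (w := fun o => o.elim (1 - ∑ v, q v / w j) (fun v => q v / w j))
    (z := fun o => o.elim 0 (fun v => Pi.single v (w j))) ?_ ?_ ?_
  · convert this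
    rw [Fintype.sum_option]
    ext u
    simp [Finset.sum_apply, Pi.single_apply, hj.ne']
  · rintro (_ | v) _
    · simp only [Option.elim]
      rw [← sum_div, sub_nonneg, div_le_one hj]
      exact hsum
    · exact div_nonneg (hq v) hj.le
  · rw [Fintype.sum_option]; simp
  · rintro (_ | v) _
    · exact zero_mem_jokerPolytope
    · exact hbot v

/-- A supporting hyperplane at a boundary point of the joker polytope. -/
lemma exists_support_jokerPolytope {j : J} (hj : 0 < w j) {q : V → ℝ}
    (hq : q ∉ interior (G.jokerPolytope w)) :
    ∃ y : V → ℝ, y ≠ 0 ∧ ∀ p ∈ G.jokerPolytope w, ∑ v, p v * y v ≤ ∑ v, q v * y v := by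
  classical
  obtain ⟨f, hf⟩ := geometric_hahn_banach_open_point (convex_jokerPolytope.interior)
    isOpen_interior hq
  have hfy : ∀ p : V → ℝ, f p = ∑ v, p v * f (Pi.single v 1) := fun p => by
    have := (f : (V → ℝ) →ₗ[ℝ] ℝ).pi_apply_eq_sum_univ p
    simp only [ContinuousLinearMap.coe_coe, smul_eq_mul] at this
    rw [this]
    refine sum_congr rfl fun v _ => ?_
    congr 2
    ext u; simp [Pi.single_apply, eq_comm]
  -- An interior point makes the separation strict, whence `y ≠ 0`, and lets the inequality pass
  -- from the interior to the whole polytope by closure.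
  have hne : (interior (G.jokerPolytope w)).Nonempty := by
    set U : Set (V → ℝ) := (⋂ v, {p | 0 < p v}) ∩ {p | ∑ v, p v < w j}
    have hU : IsOpen U := (isOpen_iInter_of_finite fun v =>
      isOpen_lt continuous_const (continuous_apply v)).inter
        (isOpen_lt (continuous_finsetSum _ fun v _ => continuous_apply v) continuous_const)
    refine ⟨fun _ => w j / (Fintype.card V + 1), interior_maximal ?_ hU ?_⟩
    · rintro p ⟨hp, hs⟩
      exact mem_jokerPolytope_of_sum_le hj (fun v => (Set.mem_iInter.1 hp v).le)
        (le_of_lt hs)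
    · refine ⟨Set.mem_iInter.2 fun v => div_pos hj (by positivity), ?_⟩
      rw [Set.mem_ofPred_eq, sum_const, nsmul_eq_mul, card_univ, ← mul_div_assoc, div_lt_iff₀ (by positivity)]
      nlinarith
  refine ⟨fun v => f (Pi.single v 1), fun h0 => ?_, fun p hp => ?_⟩
  · obtain ⟨p, hp⟩ := hne
    have := hf p hp
    have h0' : ∀ v, f (Pi.single v 1) = 0 := fun v => congrFun h0 v
    rw [hfy p, hfy q] at this
    simp [h0'] at this
  · rw [← hfy, ← hfy]
    have hcl : p ∈ closure (interior (G.jokerPolytope w)) := by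
      rw [convex_jokerPolytope.closure_interior_eq_closure_of_nonempty_interior hne]
      exact subset_closure hp
    refine closure_minimal (fun a ha => (hf a ha).le) ?_ hcl
    exact isClosed_le f.continuous continuous_const

end Polytope

/-! ### Duality and fractional tilings -/

section Fractional

variable {V J : Type*} [Fintype V] [Fintype J]

/-- The core of the argument: a constant weight distribution which is on the boundary of the
polytope has to be large. -/
lemma le_const_of_boundary [DecidableEq J] [Nonempty V] {G : SimpleGraph V} [DecidableRel G.Adj]
    {o : J} {a b ε : ℝ} (ha : 0 < a) (hab : a < b) (hsum : ∑ j, bottleWeight o a b j = 1)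
    (hJ : ∃ j, j ≠ o) (hε : 0 ≤ ε)
    (hdeg : ∀ Z : Finset V, Z.Nonempty → ∃ x ∈ Z, (#{u | ¬G.Adj x u} : ℝ) ≤
      (a + b) * Fintype.card V - a / b * min (#Z : ℝ) (b * Fintype.card V)
        + ε * Fintype.card V)
    {t : ℝ} (htpos : 0 < t) (ht : (fun _ => t) ∈ G.jokerPolytope (bottleWeight o a b))
    (hbd : (fun _ => t) ∉ interior (G.jokerPolytope (bottleWeight o a b))) :
    1 ≤ t * (Fintype.card V * (1 + ε / b)) := by
  classical
  have hb : 0 < b := ha.trans hab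
  have ht0 := htpos.le
  set w := bottleWeight o a b with hw
  have hwpos : ∀ j, 0 < w j := bottleWeight_pos ha hb o
  set N : ℝ := (Fintype.card V : ℝ) with hN
  have hNpos : 0 < N := by simp only [hN]; exact_mod_cast Fintype.card_pos
  by_contra! hlt
  obtain ⟨y, hy0, hy⟩ := exists_support_jokerPolytope (hwpos o) hbd
  set κ : ℝ := ∑ v, t * y v with hκ
  have hκ0 : 0 ≤ κ := by simpa using hy 0 zero_mem_jokerPolytope
  -- Jokers carry no load, so they get the full constant `κ`. Since the weights sum to one, the
  -- supporting inequality becomes nonnegativity of the weighted sum of `m` over each clique.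
  set m : Option V → ℝ := fun p => p.elim κ (fun v => κ - y v) with hm
  have hmeq : ∀ c : J → Option V, ∑ j, w j * m (c j) = κ - ∑ v, jokerLoad w c v * y v := by
    intro c
    rw [sum_jokerLoad_mul, ← one_mul κ, ← hsum, sum_mul, ← sum_sub_distrib]
    refine sum_congr rfl fun j _ => ?_
    rw [← mul_sub]
    cases c j <;> simp [hm]
  have hmc : ∀ c, G.IsJokerClique c → 0 ≤ ∑ j, w j * m (c j) := by
    intro c hc
    rw [hmeq, sub_nonneg]
    exact hy _ (jokerLoad_mem_jokerPolytope hc)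
  obtain ⟨p, hp0, hp1, hpt'⟩ := exists_of_mem_jokerPolytope ht
  -- Complementary slackness: the constant load attains equality in the supporting inequality, so a
  -- convex combination of nonnegative sums vanishes.
  have htight : ∀ c, p c ≠ 0 → ∑ j, w j * m (c.1 j) = 0 := by
    have h0 : ∑ c, p c * ∑ j, w j * m (c.1 j) = 0 := by
      simp only [hmeq, mul_sub, sum_sub_distrib]
      rw [← sum_mul, hp1, one_mul]
      simp only [mul_sum]
      rw [sum_comm, hκ, sub_eq_zero]
      refine sum_congr rfl fun v _ => ?_
      rw [← hpt' v, sum_mul]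
      exact sum_congr rfl fun c _ => by ring
    intro c hc
    have := (sum_eq_zero_iff_of_nonneg fun c _ => mul_nonneg (hp0 c) (hmc c.1 c.2)).1 h0 c
      (mem_univ c)
    exact (mul_eq_zero.1 this).resolve_left hc
  obtain ⟨x₀, -, hx₀⟩ := exists_min_image (univ : Finset V) (fun v => m (some v)) univ_nonempty
  set μ := m (some x₀) with hμ
  have hμmin : ∀ v, μ ≤ m (some v) := fun v => hx₀ v (mem_univ v)
  -- If `m ≥ 0` on vertices, then `y ≤ κ` and `κ ≤ t N κ` with `t N < 1`. Hence `κ = 0`, so `y ≤ 0`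
  -- has sum zero and vanishes.
  have hμneg : μ < 0 := by
    by_contra! hμ0
    have h1 : ∀ v, y v ≤ κ := fun v => by
      have := hμ0.trans (hμmin v); simp only [hm, Option.elim] at this; linarith
    have h2 : κ ≤ t * (N * κ) := by
      calc κ = t * ∑ v, y v := by rw [hκ, mul_sum]
        _ ≤ t * ∑ _v : V, κ := by gcongr with v; exact h1 v
        _ = t * (N * κ) := by simp [hN]
    have h3 : t * N < 1 := lt_of_le_of_lt (by
      rw [← mul_assoc]
      exact le_mul_of_one_le_right (mul_nonneg ht0 hNpos.le)
        (by linarith [div_nonneg hε hb.le])) hlt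
    have h4 : κ = 0 := by nlinarith
    have hs0 : ∑ v, y v = 0 := by
      rw [← mul_sum] at hκ
      exact (mul_eq_zero.1 (hκ.symm.trans h4)).resolve_left htpos.ne'
    exact hy0 (funext fun v =>
      (sum_eq_zero_iff_of_nonpos fun v _ => h4 ▸ h1 v).1 hs0 v (mem_univ v))
  have hμκ : ∀ p, μ ≤ m p := by
    rintro (_ | v)
    · simp only [hm, Option.elim]; linarith
    · exact hμmin v
  set Z : Finset V := univ.filter fun v => m (some v) = μ with hZ
  obtain ⟨x, hxZ, hx⟩ := hdeg Z ⟨x₀, by simp [hZ, hμ]⟩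
  have hxμ : m (some x) = μ := by simpa [hZ] using hxZ
  have hload : ∀ g : V → ℝ, ∑ c, p c * ∑ j, w j * (c.1 j).elim 0 g = t * ∑ v, g v := by
    intro g
    simp only [← sum_jokerLoad_mul, mul_sum]
    rw [sum_comm]
    refine sum_congr rfl fun v _ => ?_
    rw [← hpt' v, sum_mul]
    exact sum_congr rfl fun c _ => by ring
  set D : ℝ := (#{u | ¬G.Adj x u} : ℝ) with hD
  have hDsum : ∑ u, (if G.Adj x u then (0 : ℝ) else 1) = D := by
    simp [hD, sum_ite]
  have hZsum : ∑ u, (if m (some u) = m (some x) then (1 : ℝ) else 0) = #Z := by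
    simp [hZ, hxμ]
  have hnl := fun c (hc : p c ≠ 0) => nonneighbour_load_of_tight (G := G) ha hab hsum hJ hmc
    (x := x) (fun p => hxμ ▸ hμκ p) (hxμ ▸ hμneg) c.2 (htight c hc)
  have hb1 : b ≤ t * D := by
    have h1 : b = ∑ c, p c * b := by rw [← sum_mul, hp1, one_mul]
    rw [← hDsum, ← hload, h1]
    refine sum_le_sum fun c _ => ?_
    by_cases hc : p c = 0
    · simp [hc]
    · exact mul_le_mul_of_nonneg_left (hnl c hc).1 (hp0 c)
  have hb2 : a + b ≤ t * D + a / b * (t * #Z) := by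
    have h1 : a + b = ∑ c, p c * (a + b) := by rw [← sum_mul, hp1, one_mul]
    rw [← hDsum, ← hZsum, ← hload, ← hload, h1, mul_sum, ← sum_add_distrib]
    refine sum_le_sum fun c _ => ?_
    by_cases hc : p c = 0
    · simp [hc]
    · refine (mul_le_mul_of_nonneg_left (hnl c hc).2 (hp0 c)).trans (le_of_eq ?_)
      rw [← hw]
      ring
  have hεb : 0 ≤ ε / b := div_nonneg hε hb.le
  have hab0 : 0 ≤ a / b := (div_pos ha hb).le
  -- For small `Z` the two terms in `#Z` cancel in `hb2`. For large `Z` the vertex `x` has at most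
  -- `(b + ε) N` nonneighbours and `hb1` alone suffices.
  rcases le_total (#Z : ℝ) (b * N) with hz | hz
  · rw [min_eq_left hz] at hx
    have h1 : a + b ≤ t * ((a + b) * N + ε * N) := by
      calc a + b ≤ t * D + a / b * (t * #Z) := hb2
        _ = t * (D + a / b * #Z) := by ring
        _ ≤ t * ((a + b) * N + ε * N) := mul_le_mul_of_nonneg_left (by linarith) ht0
    have h2 : (a + b) * (t * (N * (1 + ε / b))) = t * ((a + b) * N + (a + b) / b * (ε * N)) := by
      field_simp
    have h3 : t * (ε * N) ≤ t * ((a + b) / b * (ε * N)) := by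
      refine mul_le_mul_of_nonneg_left (le_mul_of_one_le_left (by positivity) ?_) ht0
      rw [one_le_div hb]; linarith
    nlinarith
  · rw [min_eq_right hz] at hx
    have h1 : b ≤ t * (b * N + ε * N) := by
      refine hb1.trans (mul_le_mul_of_nonneg_left (hx.trans (le_of_eq ?_)) ht0)
      field_simp
      ring
    have h2 : b * (t * (N * (1 + ε / b))) = t * (b * N + ε * N) := by field_simp
    nlinarith

end Fractional

section Fractional

variable {V J : Type*} [Fintype V] [Fintype J]

/-- By compactness there is a largest attainable constant up to the target. If it fell short it
could not be interior, and `le_const_of_boundary` would apply. -/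
lemma const_mem_jokerPolytope [DecidableEq J] [Nonempty V] {G : SimpleGraph V}
    [DecidableRel G.Adj] {o : J} {a b ε : ℝ} (ha : 0 < a) (hab : a < b)
    (hsum : ∑ j, bottleWeight o a b j = 1) (hJ : ∃ j, j ≠ o) (hε : 0 ≤ ε)
    (hdeg : ∀ Z : Finset V, Z.Nonempty → ∃ x ∈ Z, (#{u | ¬G.Adj x u} : ℝ) ≤
      (a + b) * Fintype.card V - a / b * min (#Z : ℝ) (b * Fintype.card V)
        + ε * Fintype.card V) :
    (fun _ => 1 / (Fintype.card V * (1 + ε / b))) ∈ G.jokerPolytope (bottleWeight o a b) := by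
  have hb : 0 < b := ha.trans hab
  have hN : (0 : ℝ) < Fintype.card V := by exact_mod_cast Fintype.card_pos
  have hεb : 0 ≤ ε / b := div_nonneg hε hb.le
  set t₀ : ℝ := 1 / (Fintype.card V * (1 + ε / b)) with ht₀
  have ht₀pos : 0 < t₀ := by positivity
  set C := G.jokerPolytope (bottleWeight o a b)
  have hcont : Continuous (fun (t : ℝ) (_ : V) => t) := continuous_pi fun _ => continuous_id
  have hS : IsCompact (Set.Icc 0 t₀ ∩ (fun (t : ℝ) (_ : V) => t) ⁻¹' C) :=
    isCompact_Icc.inter_right (isCompact_jokerPolytope.isClosed.preimage hcont)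
  have hmin : 0 < min t₀ (a / Fintype.card V) := lt_min ht₀pos (div_pos ha hN)
  have hmem : min t₀ (a / Fintype.card V) ∈
      Set.Icc 0 t₀ ∩ (fun (t : ℝ) (_ : V) => t) ⁻¹' C := by
    have hpos : 0 ≤ min t₀ (a / Fintype.card V) := hmin.le
    refine ⟨⟨hpos, min_le_left _ _⟩, ?_⟩
    refine mem_jokerPolytope_of_sum_le (j := o) (by rwa [bottleWeight_self]) (fun _ => hpos) ?_
    rw [sum_const, nsmul_eq_mul, card_univ, bottleWeight_self]
    calc (Fintype.card V : ℝ) * min t₀ (a / Fintype.card V)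
        ≤ Fintype.card V * (a / Fintype.card V) := by gcongr; exact min_le_right _ _
      _ = a := by field_simp
  obtain ⟨t, ⟨⟨-, htt₀⟩, htC⟩, htmax⟩ := hS.exists_isMaxOn ⟨_, hmem⟩ continuousOn_id
  have htpos : 0 < t := lt_of_lt_of_le hmin (htmax hmem)
  rcases htt₀.eq_or_lt with rfl | hlt
  · exact htC
  exfalso
  have hbd : (fun _ => t) ∉ interior C := by
    intro hint
    have h1 : ∀ᶠ s in nhds t, (fun _ : V => s) ∈ interior C :=
      (isOpen_interior.preimage hcont).mem_nhds hint
    obtain ⟨s, hs, hs'⟩ :=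
      ((h1.filter_mono nhdsWithin_le_nhds).and (Ioo_mem_nhdsGT hlt)).exists
    have hsC : (fun _ : V => s) ∈ C := interior_subset hs
    have := htmax ⟨⟨(htpos.trans hs'.1).le, hs'.2.le⟩, hsC⟩
    exact absurd hs'.1 (not_lt.2 this)
  have := le_const_of_boundary ha hab hsum hJ hε hdeg htpos htC hbd
  rw [ht₀, lt_div_iff₀ (by positivity)] at hlt
  linarith

/-- A graph with the degree property has an almost perfect fractional tiling with ordered
cliques in which the first vertex has weight `a` and the others have weight `b`. -/
theorem exists_fractional_tiling [DecidableEq J] [DecidableEq V] {G : SimpleGraph V}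
    [DecidableRel G.Adj] {o : J} {a b ε : ℝ} (ha : 0 < a) (hab : a < b)
    (hsum : ∑ j, bottleWeight o a b j = 1) (hJ : ∃ j, j ≠ o) (hε : 0 ≤ ε)
    (hdeg : ∀ Z : Finset V, Z.Nonempty → ∃ x ∈ Z, (#{u | ¬G.Adj x u} : ℝ) ≤
      (a + b) * Fintype.card V - a / b * min (#Z : ℝ) (b * Fintype.card V)
        + ε * Fintype.card V) :
    ∃ f : (J → V) → ℝ, (∀ c, 0 ≤ f c) ∧ (∀ c, f c ≠ 0 → ∀ i j, i ≠ j → G.Adj (c i) (c j)) ∧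
      (∀ v, ∑ c, f c * ∑ j, (if c j = v then bottleWeight o a b j else 0) ≤ 1) ∧
      Fintype.card V * (1 - ε / (a * b)) ≤ ∑ c, f c := by
  classical
  have hb : 0 < b := ha.trans hab
  rcases isEmpty_or_nonempty V with hV | hV
  · exact ⟨0, by simp, by simp, by simp, by simp⟩
  set w := bottleWeight o a b with hw
  have hwpos : ∀ j, 0 < w j := bottleWeight_pos ha hb o
  have hN : (0 : ℝ) < Fintype.card V := by exact_mod_cast Fintype.card_pos
  set T : ℝ := (Fintype.card V : ℝ) * (1 + ε / b) with hT
  have hεb : 0 ≤ ε / b := div_nonneg hε hb.le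
  have hTpos : 0 < T := by positivity
  obtain ⟨p, hp0, hp1, hpt⟩ := exists_of_mem_jokerPolytope
    (const_mem_jokerPolytope (G := G) ha hab hsum hJ hε hdeg)
  set q : (J → Option V) → ℝ := fun c => if h : G.IsJokerClique c then p ⟨c, h⟩ * T else 0 with hq
  have hq0 : ∀ c, 0 ≤ q c := fun c => by
    simp only [hq]; split_ifs
    · exact mul_nonneg (hp0 _) hTpos.le
    · exact le_rfl
  have hqsum : ∀ g : (J → Option V) → ℝ, ∑ c, q c * g c = T * ∑ c, p c * g c.1 := by
    intro g
    rw [mul_sum]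
    refine (Fintype.sum_of_injective Subtype.val Subtype.val_injective _ _ ?_ ?_).symm
    · intro c hc
      have : ¬G.IsJokerClique c := fun h => hc ⟨⟨c, h⟩, rfl⟩
      simp [hq, this]
    · intro c
      simp only [hq, c.2, dite_true]
      ring
  have hqload : ∀ v, ∑ c, q c * jokerLoad w c v = 1 := by
    intro v
    have h1 : ∑ c, p c * jokerLoad w c.1 v = 1 / T := hpt v
    rw [hqsum (fun c => jokerLoad w c v), h1]
    field_simp
  set e : (J → V) → (J → Option V) := fun c j => some (c j) with he
  have hinj : Function.Injective e := fun c d h => funext fun j =>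
    Option.some_injective _ (congrFun h j)
  refine ⟨fun c => q (e c), fun c => hq0 _, ?_, ?_, ?_⟩
  · intro c hc i j hij
    have h : G.IsJokerClique (e c) := by
      by_contra h; exact hc (by simp [hq, h])
    exact h i j hij _ rfl _ rfl
  · intro v
    rw [← hqload v]
    calc ∑ c, q (e c) * ∑ j, (if c j = v then w j else 0)
        = ∑ c ∈ univ.map ⟨e, hinj⟩, q c * jokerLoad w c v := by
          rw [sum_map]
          refine sum_congr rfl fun c _ => ?_
          simp [jokerLoad, he]
      _ ≤ _ := sum_le_sum_of_subset_of_nonneg (subset_univ _) fun c _ _ =>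
          mul_nonneg (hq0 c) (jokerLoad_nonneg (fun j => (hwpos j).le) c v)
  · have h1 : ∑ c, q c = T := by
      have := hqsum (fun _ => 1)
      simpa [hp1] using this
    have h2 : ∑ c, q c * ∑ v, jokerLoad w c v = Fintype.card V := by
      simp only [mul_sum]
      rw [sum_comm]
      simp [hqload]
    have h3 : ∀ c : J → Option V, ∑ v, jokerLoad w c v = ∑ j, w j * (c j).elim 0 (fun _ => 1) := fun c => by
      simpa using sum_jokerLoad_mul w c (fun _ => 1)
    have h4 : ∑ c, q (e c) = ∑ c, q c * (if c ∈ Set.range e then 1 else 0) := by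
      refine Fintype.sum_of_injective e hinj _ _ ?_ ?_
      · intro c hc; simp [hc]
      · intro c; simp
    -- A clique with a joker wastes at least `a` of its unit weight. The total waste is `T - |V|`,
    -- so such cliques have total weight at most `(T - |V|) / a`.
    have h5 : ∀ c : J → Option V, 1 - (1 - ∑ v, jokerLoad w c v) / a ≤ if c ∈ Set.range e then 1 else 0 := by
      intro c
      have h6 : 1 - ∑ v, jokerLoad w c v = ∑ j, (w j - w j * (c j).elim 0 (fun _ => 1)) := by
        rw [h3, sum_sub_distrib, hsum]
      rw [h6]
      have hterm : ∀ j, 0 ≤ w j - w j * (c j).elim 0 (fun _ => 1) := fun j => by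
        cases c j <;> simp [(hwpos j).le]
      split_ifs with hc
      · have := div_nonneg (sum_nonneg fun j (_ : j ∈ univ) => hterm j) ha.le
        linarith
      · obtain ⟨j, hj⟩ : ∃ j, c j = none := by
          by_contra! hcon
          choose d hd using fun j => Option.ne_none_iff_exists'.1 (hcon j)
          exact hc ⟨d, funext fun j => (hd j).symm⟩
        rw [sub_nonpos, one_le_div ha]
        calc a ≤ w j := le_bottleWeight hab.le o j
          _ = w j - w j * (c j).elim 0 (fun _ => 1) := by simp [hj]
          _ ≤ _ := single_le_sum (fun i _ => hterm i) (mem_univ j)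
    rw [h4]
    calc Fintype.card V * (1 - ε / (a * b)) ≤ T - (T - Fintype.card V) / a := by
          have : T - (T - Fintype.card V) / a - Fintype.card V * (1 - ε / (a * b))
              = Fintype.card V * (ε / b) := by
            rw [hT]; field_simp; ring
          have h : 0 ≤ Fintype.card V * (ε / b) := by positivity
          linarith
      _ = ∑ c, q c * (1 - (1 - ∑ v, jokerLoad w c v) / a) := by
          have : ∀ c : J → Option V, q c * (1 - (1 - ∑ v, jokerLoad w c v) / a)
              = q c - (q c - q c * ∑ v, jokerLoad w c v) / a := fun c => by ring
          simp only [this]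
          rw [sum_sub_distrib, ← sum_div, sum_sub_distrib, h1, h2]
      _ ≤ _ := sum_le_sum fun c _ => mul_le_mul_of_nonneg_left (h5 c) (hq0 c)

end Fractional

/-! ### Embedding a copy of `H` into uniform pairs -/

section Embedding

variable {V : Type*} {G : SimpleGraph V} [DecidableRel G.Adj]

lemma card_interedges_eq_sum (S C : Finset V) :
    #(G.interedges S C) = ∑ y ∈ S, #{u ∈ C | G.Adj y u} := by
  rw [interedges_def, card_filter, sum_product]
  simp only [card_filter]

/-- In a uniform pair few vertices have much fewer neighbours than expected in a large subset. -/
lemma IsUniform.card_filter_le {ε δ β : ℝ} {A B X C : Finset V} (h : G.IsUniform ε A B)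
    (hδ : δ ≤ (G.edgeDensity A B : ℝ)) (hβ0 : 0 ≤ β) (hβ : β ≤ δ - ε) (hX : X ⊆ A) (hC : C ⊆ B)
    (hCcard : #B * ε ≤ #C) :
    (#{y ∈ X | (#{u ∈ C | G.Adj y u} : ℝ) < β * #C} : ℝ) ≤ #A * ε := by
  by_contra! hlt
  set S := {y ∈ X | (#{u ∈ C | G.Adj y u} : ℝ) < β * #C} with hS
  -- Both sets are large enough for uniformity, so their density exceeds `δ - ε ≥ β`, whereas the
  -- choice of `S` bounds it by `β`.
  have h1 := (abs_lt.1 (h ((filter_subset _ _).trans hX) hC hlt.le hCcard)).1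
  have h2 : (#(G.interedges S C) : ℝ) ≤ β * (#S * #C) := by
    rw [card_interedges_eq_sum]
    push_cast
    calc ∑ y ∈ S, (#{u ∈ C | G.Adj y u} : ℝ) ≤ ∑ y ∈ S, β * #C :=
          sum_le_sum fun y hy => (mem_filter.1 hy).2.le
      _ = _ := by rw [sum_const, nsmul_eq_mul]; ring
  have h3 : (G.edgeDensity S C : ℝ) ≤ β := by
    rw [edgeDensity_def]
    push_cast
    exact div_le_of_le_mul₀ (by positivity) hβ0 h2
  linarith

/-- A graph can be embedded into large subsets of pairwise uniform and dense clusters. -/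
theorem exists_copy_of_isUniform {W : Type*} [Fintype W] (H : SimpleGraph W) {ε δ β γ : ℝ}
    (hβ0 : 0 < β) (hβ1 : β ≤ 1) (hβ : β ≤ δ - ε) (hγ : 0 ≤ γ) (hε : 0 < ε)
    (hεγ : (Fintype.card W + 1) * ε ≤ β ^ Fintype.card W * γ)
    {A U : W → Finset V} (hU : ∀ w, U w ⊆ A w) (hUcard : ∀ w, γ * #(A w) ≤ #(U w))
    (hA : ∀ w, (Fintype.card W : ℝ) ≤ #(A w) * ε)
    (huni : ∀ w w', H.Adj w w' → G.IsUniform ε (A w) (A w'))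
    (hdens : ∀ w w', H.Adj w w' → δ ≤ (G.edgeDensity (A w) (A w') : ℝ)) :
    ∃ φ : Copy H G, ∀ w, φ w ∈ U w := by
  classical
  -- The vertices of `H` are placed one at a time; each placement shrinks the candidate set of any
  -- unplaced vertex by a factor of at worst `β`.
  suffices key : ∀ D : Finset W, ∃ φ : W → V, Set.InjOn φ D ∧ (∀ d ∈ D, φ d ∈ U d) ∧
      (∀ d ∈ D, ∀ d' ∈ D, H.Adj d d' → G.Adj (φ d) (φ d')) ∧
      ∀ w ∉ D, β ^ #D * (γ * #(A w)) ≤ #{u ∈ U w | ∀ d ∈ D, H.Adj d w → G.Adj (φ d) u} by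
    obtain ⟨φ, h1, h2, h3, -⟩ := key univ
    refine ⟨⟨⟨φ, fun {w w'} h => h3 w (mem_univ _) w' (mem_univ _) h⟩, ?_⟩,
      fun w => h2 w (mem_univ _)⟩
    intro w w' h
    exact h1 (by simp) (by simp) h
  intro D
  induction D using Finset.induction_on with
  | empty =>
    by_cases hV : Nonempty V
    · exact ⟨fun _ => hV.some, by simp, by simp, by simp, fun w _ => by simpa using hUcard w⟩
    · have hW : IsEmpty W := by
        refine ⟨fun w => ?_⟩
        have h1 : A w = ∅ := eq_empty_of_forall_notMem fun v => (hV ⟨v⟩).elim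
        have h2 := hA w
        rw [h1] at h2
        have : 0 < Fintype.card W := Fintype.card_pos_iff.2 ⟨w⟩
        simp at h2
        omega
      exact ⟨hW.elim, by simp, by simp, by simp, fun w => hW.elim w⟩
  | insert w D hwD ih =>
    obtain ⟨φ, hinj, hmem, hadj, hcand⟩ := ih
    set h := Fintype.card W with hh
    set C : W → Finset V := fun w => {u ∈ U w | ∀ d ∈ D, H.Adj d w → G.Adj (φ d) u} with hC
    have hCA : ∀ w, C w ⊆ A w := fun w => (filter_subset _ _).trans (hU w)
    have hDh : #D < h := by
      have := card_lt_univ_of_notMem hwD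
      simpa [hh] using this
    have hCbig : ∀ w ∉ D, (h + 1) * ε * #(A w) ≤ #(C w) := by
      intro w hw
      refine le_trans ?_ (hcand w hw)
      rw [← mul_assoc]
      refine mul_le_mul_of_nonneg_right (hεγ.trans ?_) (Nat.cast_nonneg _)
      exact mul_le_mul_of_nonneg_right (pow_le_pow_of_le_one hβ0.le hβ1 hDh.le) hγ
    have hCuni : ∀ w ∉ D, #(A w) * ε ≤ #(C w) := by
      intro w hw
      refine le_trans ?_ (hCbig w hw)
      have : (0 : ℝ) ≤ h * (ε * #(A w)) := by positivity
      linarith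
    set bad : W → Finset V := fun w' => {y ∈ C w | (#{u ∈ C w' | G.Adj y u} : ℝ) < β * #(C w')}
    set S : Finset W := {w' | w' ∉ D ∧ H.Adj w w'}
    have hbad : ∀ w' ∈ S, (#(bad w') : ℝ) ≤ #(A w) * ε := by
      intro w' hw'
      obtain ⟨hw'D, hww'⟩ := (mem_filter.1 hw').2
      exact (huni w w' hww').card_filter_le (hdens w w' hww') hβ0.le hβ (hCA w) (hCA w')
        (hCuni w' hw'D)
    -- Fewer than `h ≤ ε |A w|` vertices are used, and each of at most `h` unplaced neighbours rules
    -- out at most `ε |A w|` candidates. This is less than `(h + 1) ε |A w|`.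
    obtain ⟨y, hyC, hy⟩ : ∃ y ∈ C w, y ∉ D.image φ ∪ S.biUnion bad := by
      by_contra! hcon
      have h1 : #(C w) ≤ #D + ∑ w' ∈ S, #(bad w') :=
        (card_le_card hcon).trans ((card_union_le _ _).trans
          (add_le_add card_image_le card_biUnion_le))
      have h2 : (#(C w) : ℝ) ≤ #D + ∑ w' ∈ S, (#(bad w') : ℝ) := by exact_mod_cast h1
      have h3 : ∑ w' ∈ S, (#(bad w') : ℝ) ≤ h * (#(A w) * ε) := by
        refine (sum_le_sum hbad).trans ?_
        rw [sum_const, nsmul_eq_mul]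
        refine mul_le_mul_of_nonneg_right ?_ (by positivity)
        exact_mod_cast card_le_univ S
      have h4 : (#D : ℝ) < h := by exact_mod_cast hDh
      have h5 := hCbig w hwD
      have h6 := hA w
      linarith
    rw [mem_union, not_or] at hy
    obtain ⟨hy1, hy2⟩ := hy
    have hyU : y ∈ U w := (mem_filter.1 hyC).1
    have hyadj : ∀ d ∈ D, H.Adj d w → G.Adj (φ d) y := (mem_filter.1 hyC).2
    have hne : ∀ d ∈ D, d ≠ w := fun d hd h => hwD (h ▸ hd)
    have hupd : ∀ d ∈ D, Function.update φ w y d = φ d := fun d hd =>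
      Function.update_of_ne (hne d hd) _ _
    refine ⟨Function.update φ w y, ?_, ?_, ?_, ?_⟩
    · rw [coe_insert, Set.injOn_insert (by simpa using hwD)]
      refine ⟨hinj.congr fun d hd => (hupd d hd).symm, ?_⟩
      rintro ⟨d, hd, hdy⟩
      rw [hupd d hd, Function.update_self] at hdy
      exact hy1 (mem_image.2 ⟨d, hd, hdy⟩)
    · intro d hd
      rcases mem_insert.1 hd with rfl | hd
      · rwa [Function.update_self]
      · rw [hupd d hd]; exact hmem d hd
    · intro d hd d' hd' hdd'
      rcases mem_insert.1 hd with rfl | hdD <;> rcases mem_insert.1 hd' with rfl | hdD'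
      · exact absurd hdd' H.irrefl
      · rw [Function.update_self, hupd d' hdD']; exact (hyadj d' hdD' hdd'.symm).symm
      · rw [Function.update_self, hupd d hdD]; exact hyadj d hdD hdd'
      · rw [hupd d hdD, hupd d' hdD']; exact hadj d hdD d' hdD' hdd'
    · intro w' hw'
      rw [mem_insert, not_or] at hw'
      have hfil : ∀ u ∈ C w', (H.Adj w w' → G.Adj y u) →
          u ∈ ({u ∈ U w' | ∀ d ∈ insert w D, H.Adj d w' →
            G.Adj (Function.update φ w y d) u} : Finset V) := by
        intro u hu huy
        rw [hC, mem_filter] at hu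
        refine mem_filter.2 ⟨hu.1, fun d hd hdw' => ?_⟩
        rcases mem_insert.1 hd with rfl | hd
        · rw [Function.update_self]; exact huy hdw'
        · rw [hupd d hd]; exact hu.2 d hd hdw'
      have hprev := hcand w' hw'.2
      rw [card_insert_of_notMem hwD, pow_succ, mul_comm (β ^ #D) β, mul_assoc]
      by_cases hadjw : H.Adj w w'
      · have h1 : β * #(C w') ≤ (#{u ∈ C w' | G.Adj y u} : ℝ) := by
          by_contra! hlt
          exact hy2 (mem_biUnion.2 ⟨w', mem_filter.2 ⟨mem_univ _, hw'.2, hadjw⟩,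
            mem_filter.2 ⟨hyC, hlt⟩⟩)
        refine (mul_le_mul_of_nonneg_left hprev hβ0.le).trans (h1.trans ?_)
        refine Nat.cast_le.2 (card_le_card fun u hu => ?_)
        exact hfil u (mem_filter.1 hu).1 fun _ => (mem_filter.1 hu).2
      · have h0 : 0 ≤ β ^ #D * (γ * #(A w')) := by positivity
        refine (mul_le_of_le_one_left h0 hβ1).trans (hprev.trans ?_)
        exact Nat.cast_le.2 (card_le_card fun u hu => hfil u hu fun h => absurd h hadjw)

end Embedding

/-! ### Greedy packing of disjoint copies -/

section Packing

variable {V W ι κ : Type*} {G : SimpleGraph V} {H : SimpleGraph W}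

open scoped Classical in
/-- Greedy packing: if copies of `H` of every required type can be found in large subsets of the
clusters `A k`, then any number of them can be packed that does not overload a cluster. -/
lemma exists_disjoint_copies [Fintype W] [Fintype ι] [Nonempty W] {A : κ → Finset V}
    (hA : Pairwise (Function.onFun Disjoint A)) (cl : ι → W → κ) {γ : ℝ} (q : ι → ℕ)
    (hemb : ∀ t, q t ≠ 0 → ∀ U : κ → Finset V, (∀ k, U k ⊆ A k) →
      (∀ k, γ * #(A k) ≤ #(U k)) → ∃ φ : Copy H G, ∀ w, φ w ∈ U (cl t w))
    (hq : ∀ k, (∑ t, q t * #{w | cl t w = k} : ℝ) ≤ (1 - γ) * #(A k)) :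
    ∃ S : Finset (Copy H G), #S = ∑ t, q t ∧
      (∀ φ ∈ S, ∀ ψ ∈ S, φ ≠ ψ → Disjoint (Set.range φ) (Set.range ψ)) ∧
      ∀ k, #{v ∈ A k | ∃ φ ∈ S, v ∈ Set.range φ} ≤ ∑ t, q t * #{w | cl t w = k} := by
  induction hn : ∑ t, q t generalizing q with
  | zero => exact ⟨∅, by simp⟩
  | succ n ih =>
    obtain ⟨t₀, ht₀⟩ : ∃ t, q t ≠ 0 := by
      by_contra! hcon
      simp [hcon] at hn
    obtain ⟨q', rfl⟩ : ∃ q', q = q' + Pi.single t₀ 1 := by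
      refine ⟨q - Pi.single t₀ 1, (tsub_add_cancel_of_le ?_).symm⟩
      intro t
      by_cases h : t = t₀
      · subst h; simpa using Nat.one_le_iff_ne_zero.2 ht₀
      · simp [h]
    have hload : ∀ k, ∑ t, (q' + Pi.single t₀ 1 : ι → ℕ) t * #{w | cl t w = k}
        = ∑ t, q' t * #{w | cl t w = k} + #{w | cl t₀ w = k} := by
      intro k
      simp only [Pi.add_apply, add_mul, sum_add_distrib]
      congr 1
      rw [sum_eq_single t₀] <;> simp +contextual
    have hn' : ∑ t, q' t = n := by
      simp only [Pi.add_apply, sum_add_distrib, sum_pi_single', mem_univ, if_true] at hn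
      omega
    have hq' : ∀ k, (∑ t, q' t * #{w | cl t w = k} : ℝ) + #{w | cl t₀ w = k}
        ≤ (1 - γ) * #(A k) := by
      intro k
      refine le_trans (le_of_eq ?_) (hq k)
      exact_mod_cast (hload k).symm
    obtain ⟨S, hScard, hSdisj, hSload⟩ := ih q'
      (fun t ht => hemb t (by simp only [Pi.add_apply]; omega))
      (fun k => le_trans (by simp) (hq' k)) hn'
    set X : κ → Finset V := fun k => {v ∈ A k | ∃ φ ∈ S, v ∈ Set.range φ} with hX
    -- By the load bound, at least a `γ` fraction of each cluster is still unused.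
    obtain ⟨φ, hφ⟩ := hemb t₀ ht₀ (fun k => A k \ X k) (fun k => sdiff_subset) (fun k => by
      have h1 : #(A k \ X k) + #(X k) = #(A k) := card_sdiff_add_card_eq_card (filter_subset _ _)
      have h2 : (#(A k \ X k) : ℝ) + #(X k) = #(A k) := by exact_mod_cast h1
      have h3 : (#(X k) : ℝ) ≤ (∑ t, q' t * #{w | cl t w = k} : ℝ) := by exact_mod_cast hSload k
      have h4 := hq' k
      have h5 : (0 : ℝ) ≤ #{w | cl t₀ w = k} := Nat.cast_nonneg _
      linarith)
    have hφA : ∀ w, φ w ∈ A (cl t₀ w) := fun w => (mem_sdiff.1 (hφ w)).1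
    have hφS : ∀ w, ∀ ψ ∈ S, φ w ∉ Set.range ψ := fun w ψ hψ hmem =>
      (mem_sdiff.1 (hφ w)).2 (mem_filter.2 ⟨hφA w, ψ, hψ, hmem⟩)
    have hdisj : ∀ ψ ∈ S, Disjoint (Set.range φ) (Set.range ψ) := by
      intro ψ hψ
      rw [Set.disjoint_left]
      rintro _ ⟨w, rfl⟩
      exact hφS w ψ hψ
    have hφnot : φ ∉ S := fun h =>
      hφS (Classical.arbitrary W) φ h (Set.mem_range_self _)
    refine ⟨insert φ S, by rw [card_insert_of_notMem hφnot, hScard], ?_, ?_⟩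
    · intro ψ hψ θ hθ hne
      rcases mem_insert.1 hψ with rfl | hψS <;> rcases mem_insert.1 hθ with rfl | hθS
      · exact absurd rfl hne
      · exact hdisj θ hθS
      · exact (hdisj ψ hψS).symm
      · exact hSdisj ψ hψS θ hθS hne
    · intro k
      rw [hload k]
      have hsub : ({v ∈ A k | ∃ ψ ∈ insert φ S, v ∈ Set.range ψ} : Finset V) ⊆
          X k ∪ image φ {w | cl t₀ w = k} := by
        intro v hv
        obtain ⟨hvA, ψ, hψ, hvψ⟩ := mem_filter.1 hv
        rcases mem_insert.1 hψ with rfl | hψS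
        · obtain ⟨w, rfl⟩ := hvψ
          refine mem_union_right _ (mem_image_of_mem _ (mem_filter.2 ⟨mem_univ _, ?_⟩))
          by_contra hne
          have hd : Disjoint (A (cl t₀ w)) (A k) := hA hne
          exact Finset.disjoint_left.1 hd (hφA w) hvA
        · exact mem_union_left _ (mem_filter.2 ⟨hvA, ψ, hψS, hvψ⟩)
      exact (card_le_card hsub).trans ((card_union_le _ _).trans
        (add_le_add (hSload k) card_image_le))

lemma verts_toSubgraph (φ : Copy H G) : φ.toSubgraph.verts = Set.range φ := by
  ext v; simp [Copy.toSubgraph]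

lemma exists_tiling_of_disjoint_copies [Fintype W] [Finite V] (S : Finset (Copy H G))
    (hS : ∀ φ ∈ S, ∀ ψ ∈ S, φ ≠ ψ → Disjoint (Set.range φ) (Set.range ψ)) :
    ∃ T : Set G.Subgraph, H.IsTiling G T ∧ (coveredVerts T).ncard = Fintype.card W * #S := by
  classical
  refine ⟨Copy.toSubgraph '' (S : Set (Copy H G)), ⟨?_, ?_⟩, ?_⟩
  · rintro _ ⟨φ, -, rfl⟩
    exact ⟨φ.isoToSubgraph⟩
  · rintro _ ⟨φ, hφ, rfl⟩ _ ⟨ψ, hψ, rfl⟩ hne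
    rw [Function.onFun, verts_toSubgraph, verts_toSubgraph]
    exact hS φ hφ ψ hψ fun h => hne (by rw [h])
  · have h1 : coveredVerts (Copy.toSubgraph '' (S : Set (Copy H G))) =
        ((S.biUnion fun φ => univ.image φ : Finset V) : Set V) := by
      ext v
      simp [coveredVerts]
    rw [h1, Set.ncard_coe_finset, card_biUnion]
    · rw [sum_congr rfl fun (φ : Copy H G) _ => card_image_of_injective univ
        (show Function.Injective (⇑φ) from φ.injective)]
      simp [mul_comm]
    · intro φ hφ ψ hψ hne
      rw [Function.onFun, ← disjoint_coe]
      simpa using hS φ hφ ψ hψ hne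

end Packing

/-! ### The reduced graph inherits the degree condition -/

section Reduced

variable {V : Type*}

/-- The reduced graph on a family of clusters. -/
def reducedGraph (G : SimpleGraph V) [DecidableRel G.Adj] (ε δ : ℝ) (Q : Finset (Finset V)) :
    SimpleGraph Q where
  Adj A B := A ≠ B ∧ G.IsUniform ε A.1 B.1 ∧ δ ≤ (G.edgeDensity A.1 B.1 : ℝ)
  symm := ⟨fun A B h => ⟨h.1.symm, h.2.1.symm, by rw [edgeDensity_comm]; exact h.2.2⟩⟩
  loopless := ⟨fun _ h => h.1 rfl⟩

variable [Fintype V] [DecidableEq V] {G : SimpleGraph V} [DecidableRel G.Adj]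

/-- The parts of a partition that form uniform pairs with most other parts. -/
noncomputable def goodParts (G : SimpleGraph V) [DecidableRel G.Adj]
    (P : Finpartition (univ : Finset V)) (ε θ : ℝ) : Finset (Finset V) :=
  {A ∈ P.parts | (#{B ∈ P.parts | A ≠ B ∧ ¬G.IsUniform ε A B} : ℝ) ≤ θ * #P.parts}

/-- Double counting: a discarded part lies in more than `θ k` nonuniform ordered pairs, out of at
most `θ² k²` in total. Discarding is needed because regularity bounds the nonuniform pairs only
globally, not at each part. -/
lemma le_card_goodParts {P : Finpartition (univ : Finset V)} {ε θ : ℝ} (hε : 0 ≤ ε) (hθ : 0 < θ)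
    (hεθ : ε ≤ θ ^ 2) (hP : P.IsUniform G ε) :
    (1 - θ) * #P.parts ≤ #(goodParts G P ε θ) := by
  rcases P.parts.eq_empty_or_nonempty with h0 | h0
  · simp [h0]
  have hk : (0 : ℝ) < #P.parts := by exact_mod_cast h0.card_pos
  set k : ℝ := (#P.parts : ℝ) with hkdef
  set bad : Finset (Finset V) :=
    {A ∈ P.parts | ¬(#{B ∈ P.parts | A ≠ B ∧ ¬G.IsUniform ε A B} : ℝ) ≤ θ * #P.parts} with hbad
  have h1 : #(goodParts G P ε θ) + #bad = #P.parts := card_filter_add_card_filter_not _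
  have h1' : (#(goodParts G P ε θ) : ℝ) + #bad = k := by rw [hkdef]; exact_mod_cast h1
  have h2 : ∑ A ∈ P.parts, #{B ∈ P.parts | A ≠ B ∧ ¬G.IsUniform ε A B} = #(P.nonUniforms G ε) := by
    have : P.nonUniforms G ε =
        {AB ∈ P.parts ×ˢ P.parts | AB.1 ≠ AB.2 ∧ ¬G.IsUniform ε AB.1 AB.2} := by
      ext ⟨A, B⟩
      simp [and_assoc]
    rw [this, card_filter, sum_product]
    simp only [card_filter]
  have h3 : (#bad : ℝ) * (θ * k) ≤ #(P.nonUniforms G ε) := by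
    rw [← h2]
    push_cast
    calc (#bad : ℝ) * (θ * k) = ∑ A ∈ bad, θ * k := by rw [sum_const, nsmul_eq_mul]
      _ ≤ ∑ A ∈ bad, (#{B ∈ P.parts | A ≠ B ∧ ¬G.IsUniform ε A B} : ℝ) :=
          sum_le_sum fun A hA => (not_le.1 (mem_filter.1 hA).2).le
      _ ≤ _ := sum_le_sum_of_subset_of_nonneg (filter_subset _ _) fun _ _ _ => by positivity
  have h4 : (#(P.nonUniforms G ε) : ℝ) ≤ k * k * θ ^ 2 := by
    refine hP.trans ?_
    push_cast
    refine mul_le_mul (mul_le_mul_of_nonneg_left ?_ hk.le) hεθ hε (by positivity)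
    rw [hkdef]
    exact Nat.cast_le.2 (Nat.sub_le _ _)
  have h5 : (#bad : ℝ) ≤ θ * k := by
    have : (#bad : ℝ) * (θ * k) ≤ (θ * k) * (θ * k) := by nlinarith
    exact le_of_mul_le_mul_right this (by positivity)
  linarith

/-- A large set of vertices of large degree inside a good part makes the degree of this part in
the reduced graph large. -/
lemma le_degree_reducedGraph {P : Finpartition (univ : Finset V)} {ε δ θ τ M : ℝ}
    (hεδ : 0 ≤ δ + ε) (hM : ∀ B ∈ P.parts, (#B : ℝ) ≤ M)
    {Q : Finset (Finset V)} (hQP : Q ⊆ P.parts) (hQcard : (1 - θ) * #P.parts ≤ #Q)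
    (hQuni : ∀ A ∈ Q, (#{B ∈ P.parts | A ≠ B ∧ ¬G.IsUniform ε A B} : ℝ) ≤ θ * #P.parts)
    (A : Q) {A' : Finset V} (hA' : A' ⊆ A.1) (hne : A'.Nonempty)
    (hcard : #A.1 * ε ≤ #A') (hε1 : ε ≤ 1) (hdeg : ∀ v ∈ A', τ ≤ G.degree v) :
    τ ≤ Set.ncard {B | (G.reducedGraph ε δ Q).Adj A B} * M
      + (δ + ε) * Fintype.card V + (2 * θ * #P.parts + 1) * M := by
  classical
  set R := G.reducedGraph ε δ Q with hR
  have hAP : A.1 ∈ P.parts := hQP A.2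
  set N₁ : Finset (Finset V) := {B ∈ P.parts | A.1 ≠ B ∧ ¬G.IsUniform ε A.1 B} with hN₁
  set N₂ : Finset (Finset V) := (univ.filter fun B : Q => R.Adj A B).image Subtype.val with hN₂
  -- Outside `F` a part is uniform with `A` but of density below `δ`, so it has density at most `δ +
  -- ε` to `A'`. The parts in `F` are bounded trivially; apart from the reduced neighbours of `A`
  -- there are few of them.
  set F : Finset (Finset V) := ({A.1} ∪ N₁) ∪ ((P.parts \ Q) ∪ N₂) with hF
  have hFP : F ⊆ P.parts := by
    intro B hB
    simp only [hF, mem_union, mem_singleton] at hB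
    rcases hB with (rfl | hB) | (hB | hB)
    · exact hAP
    · exact (mem_filter.1 hB).1
    · exact (mem_sdiff.1 hB).1
    · obtain ⟨C, -, rfl⟩ := mem_image.1 hB
      exact hQP C.2
  have hM0 : 0 ≤ M := (Nat.cast_nonneg _).trans (hM _ hAP)
  set d : ℝ := (Set.ncard {B | R.Adj A B} : ℝ) with hd
  have hFcard : (#F : ℝ) ≤ d + (2 * θ * #P.parts + 1) := by
    have h1 : #F ≤ (1 + #N₁) + (#(P.parts \ Q) + #N₂) := by
      refine (card_union_le _ _).trans (add_le_add ?_ (card_union_le _ _))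
      exact (card_union_le _ _).trans (by simp)
    have h2 : (#F : ℝ) ≤ (1 + #N₁) + (#(P.parts \ Q) + #N₂) := by exact_mod_cast h1
    have h3 : (#N₁ : ℝ) ≤ θ * #P.parts := hQuni A.1 A.2
    have h4 : (#(P.parts \ Q) : ℝ) + #Q = #P.parts := by
      exact_mod_cast card_sdiff_add_card_eq_card hQP
    have h5 : (#N₂ : ℝ) ≤ d := by
      rw [hd, Set.ncard_eq_toFinset_card']
      refine Nat.cast_le.2 (card_image_le.trans (le_of_eq ?_))
      congr 1
      ext B; simp
    linarith
  have hcardA' : (0 : ℝ) < #A' := by exact_mod_cast hne.card_pos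
  have hbig : ∀ B ∈ P.parts, (#(G.interedges A' B) : ℝ) ≤ #A' * M := by
    intro B hB
    calc (#(G.interedges A' B) : ℝ) ≤ #A' * #B := by exact_mod_cast G.card_interedges_le_mul A' B
      _ ≤ _ := mul_le_mul_of_nonneg_left (hM B hB) hcardA'.le
  have hsmall : ∀ B ∈ P.parts \ F, (#(G.interedges A' B) : ℝ) ≤ #A' * ((δ + ε) * #B) := by
    intro B hB
    obtain ⟨hBP, hBF⟩ := mem_sdiff.1 hB
    simp only [hF, mem_union, mem_singleton, not_or, hN₁, mem_filter, mem_sdiff, not_and,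
      not_not] at hBF
    obtain ⟨⟨h1, h2⟩, h3, h4⟩ := hBF
    have huni : G.IsUniform ε A.1 B := h2 hBP (Ne.symm h1)
    have hBQ : B ∈ Q := h3 hBP
    have hdens : (G.edgeDensity A.1 B : ℝ) < δ := by
      by_contra! hle
      refine h4 (mem_image.2 ⟨⟨B, hBQ⟩, mem_filter.2 ⟨mem_univ _, ?_, huni, hle⟩, rfl⟩)
      intro h
      exact h1 (congrArg Subtype.val h).symm
    have hB0 : (0 : ℝ) < #B := by exact_mod_cast (P.nonempty_of_mem_parts hBP).card_pos
    have h5 := (abs_lt.1 (huni hA' subset_rfl hcard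
      (mul_le_of_le_one_right hB0.le hε1))).2
    have h6 : (G.edgeDensity A' B : ℝ) ≤ δ + ε := by linarith
    rw [edgeDensity_def] at h6
    push_cast at h6
    rw [div_le_iff₀ (by positivity)] at h6
    linarith
  have hsum : (#A' : ℝ) * τ ≤ ∑ B ∈ P.parts, (#(G.interedges A' B) : ℝ) := by
    have h1 : ∑ B ∈ P.parts, #(G.interedges A' B) = #(G.interedges A' univ) :=
      (Rel.card_interedges_finpartition_right G.Adj A' P).symm
    have h2 : #(G.interedges A' univ) = ∑ v ∈ A', G.degree v := by
      rw [card_interedges_eq_sum]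
      refine sum_congr rfl fun v _ => ?_
      rw [← card_neighborFinset_eq_degree]
      congr 1
      ext u; simp
    have h3 : ∑ B ∈ P.parts, (#(G.interedges A' B) : ℝ) = ∑ v ∈ A', (G.degree v : ℝ) := by
      exact_mod_cast h1.trans h2
    rw [h3, ← nsmul_eq_mul, ← sum_const]
    exact sum_le_sum fun v hv => hdeg v hv
  have hcardV : ∑ B ∈ P.parts, (#B : ℝ) = Fintype.card V := by
    have := P.sum_card_parts
    rw [card_univ] at this
    exact_mod_cast this
  have hfinal : (#A' : ℝ) * τ ≤ #A' * (#F * M + (δ + ε) * Fintype.card V) := by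
    refine hsum.trans ?_
    rw [← sum_sdiff hFP]
    have e1 : ∑ B ∈ P.parts \ F, (#(G.interedges A' B) : ℝ)
        ≤ #A' * ((δ + ε) * Fintype.card V) := by
      refine (sum_le_sum hsmall).trans ?_
      rw [← mul_sum, ← mul_sum, ← hcardV]
      refine mul_le_mul_of_nonneg_left (mul_le_mul_of_nonneg_left ?_ hεδ) hcardA'.le
      exact sum_le_sum_of_subset_of_nonneg sdiff_subset fun _ _ _ => by positivity
    have e2 : ∑ B ∈ F, (#(G.interedges A' B) : ℝ) ≤ #A' * (#F * M) := by
      refine (sum_le_sum fun B hB => hbig B (hFP hB)).trans (le_of_eq ?_)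
      rw [sum_const, nsmul_eq_mul]; ring
    linarith
  have := le_of_mul_le_mul_left hfinal hcardA'
  have h7 := mul_le_mul_of_nonneg_right hFcard hM0
  linarith

end Reduced

/-- The degree property is inherited by the reduced graph. -/
lemma reducedGraph_degree_property {V : Type*} [Fintype V] [DecidableEq V] {G : SimpleGraph V}
    [DecidableRel G.Adj] {P : Finpartition (univ : Finset V)} {a b ε δ θ ρ : ℝ}
    (ha : 0 < a) (hab : a < b) (hab1 : a + b ≤ 1) (hε : 0 < ε) (hε1 : ε ≤ 1) (hδ : 0 ≤ δ)
    (hθ : 0 ≤ θ) (hθ2 : θ ≤ 1 / 2) (hρ1 : ρ ≤ 1) {m : ℕ}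
    (hm : ∀ B ∈ P.parts, m ≤ #B) (hm1 : ∀ B ∈ P.parts, #B ≤ m + 1)
    (hk : 1 ≤ ρ * #P.parts) (hkn : #P.parts ≤ ρ * Fintype.card V)
    {Q : Finset (Finset V)} (hQP : Q ⊆ P.parts) (hQcard : (1 - θ) * #P.parts ≤ #Q)
    (hQuni : ∀ A ∈ Q, (#{B ∈ P.parts | A ≠ B ∧ ¬G.IsUniform ε A B} : ℝ) ≤ θ * #P.parts)
    (hG : ∀ S : Finset V, S.Nonempty → ∃ v ∈ S, (1 - a - b) * Fintype.card V
      + a / b * min (#S : ℝ) (b * Fintype.card V) - 1 ≤ G.degree v)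
    (Z : Finset Q) (hZ : Z.Nonempty) :
    ∃ A ∈ Z, (1 - a - b) * #Q + a / b * min (#Z : ℝ) (b * #Q)
      - 2 * (δ + 2 * ε + 4 * θ + 5 * ρ) * #Q
        ≤ Set.ncard {B | (G.reducedGraph ε δ Q).Adj A B} := by
  have hb : 0 < b := ha.trans hab
  set n : ℝ := (Fintype.card V : ℝ) with hn
  set k : ℝ := (#P.parts : ℝ) with hkdef
  set N : ℝ := (#Q : ℝ) with hN
  set z : ℝ := (#Z : ℝ) with hz
  have hk0 : 0 ≤ k := Nat.cast_nonneg _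
  have hn0 : 0 ≤ n := Nat.cast_nonneg _
  have hρ : 0 ≤ ρ := by by_contra! h; nlinarith
  have hk1 : 1 ≤ k := by nlinarith
  have hNk : N ≤ k := Nat.cast_le.2 (card_le_card hQP)
  have hzN : z ≤ N := by
    have := card_le_univ Z
    rw [Fintype.card_coe] at this
    exact Nat.cast_le.2 this
  have hz0 : 0 ≤ z := Nat.cast_nonneg _
  have hsumn : ∑ B ∈ P.parts, (#B : ℝ) = n := by
    have := P.sum_card_parts
    rw [card_univ] at this
    rw [hn]
    exact_mod_cast this
  have hkm : k * m ≤ n := by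
    rw [← hsumn, hkdef, ← nsmul_eq_mul, ← sum_const]
    exact sum_le_sum fun B hB => Nat.cast_le.2 (hm B hB)
  have hnk : n ≤ k * (m + 1) := by
    rw [← hsumn, hkdef, ← nsmul_eq_mul, ← sum_const]
    exact sum_le_sum fun B hB => by exact_mod_cast hm1 B hB
  set τ : ℝ := (1 - a - b) * n + a / b * min ((1 - ε) * m * z) (b * n) - 1 with hτ
  have hab0 : 0 ≤ a / b := (div_pos ha hb).le
  have hab1' : a / b ≤ 1 := (div_le_one hb).2 hab.le
  -- Otherwise almost all vertices of each cluster in `Z` have degree below `τ`. Together they form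
  -- a set of size at least `(1 - ε) m z`, in which `hG` finds a vertex of degree at least `τ`.
  obtain ⟨A, hAZ, hA⟩ : ∃ A ∈ Z, (#A.1 : ℝ) * ε ≤ #{v ∈ A.1 | τ ≤ G.degree v} := by
    by_contra! hcon
    have hlow : ∀ A ∈ Z, (1 - ε) * (#A.1 : ℝ) < #{v ∈ A.1 | ¬τ ≤ (G.degree v : ℝ)} := by
      intro A hA
      have h1 : (#{v ∈ A.1 | τ ≤ (G.degree v : ℝ)} : ℝ) + #{v ∈ A.1 | ¬τ ≤ (G.degree v : ℝ)}
          = #A.1 := by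
        exact_mod_cast card_filter_add_card_filter_not (s := A.1) fun v => τ ≤ (G.degree v : ℝ)
      linarith [hcon A hA]
    set S : Finset V := Z.biUnion fun A => {v ∈ A.1 | ¬τ ≤ (G.degree v : ℝ)} with hS
    have hScard : (1 - ε) * m * z ≤ #S := by
      rw [hS, card_biUnion]
      · push_cast
        calc (1 - ε) * m * z = ∑ A ∈ Z, (1 - ε) * m := by
              rw [sum_const, nsmul_eq_mul, mul_comm]
          _ ≤ _ := sum_le_sum fun A hA => le_trans (mul_le_mul_of_nonneg_left
              (Nat.cast_le.2 (hm _ (hQP A.2))) (by linarith)) (hlow A hA).le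
      · intro A _ B _ hne
        exact (P.disjoint (hQP A.2) (hQP B.2) fun h => hne (Subtype.ext h)).mono
          (filter_subset _ _) (filter_subset _ _)
    have hSne : S.Nonempty := by
      obtain ⟨A, hA⟩ := hZ
      have h1 : (0 : ℝ) < #{v ∈ A.1 | ¬τ ≤ (G.degree v : ℝ)} :=
        lt_of_le_of_lt (mul_nonneg (by linarith) (Nat.cast_nonneg _)) (hlow A hA)
      obtain ⟨v, hv⟩ := card_pos.1 (Nat.cast_pos.1 h1)
      exact ⟨v, mem_biUnion.2 ⟨A, hA, hv⟩⟩
    obtain ⟨v, hvS, hv⟩ := hG S hSne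
    obtain ⟨A, -, hvA⟩ := mem_biUnion.1 hvS
    refine (mem_filter.1 hvA).2 (le_trans ?_ hv)
    rw [hτ]
    gcongr
  refine ⟨A, hAZ, ?_⟩
  have hA0 : (0 : ℝ) < #A.1 := by
    exact_mod_cast (P.nonempty_of_mem_parts (hQP A.2)).card_pos
  have hmain := le_degree_reducedGraph (G := G) (P := P) (ε := ε) (δ := δ) (θ := θ) (τ := τ)
    (M := m + 1) (by linarith) (fun B hB => by exact_mod_cast hm1 B hB) hQP hQcard hQuni A
    (A' := {v ∈ A.1 | τ ≤ G.degree v}) (filter_subset _ _)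
    (card_pos.1 (Nat.cast_pos.1 (lt_of_lt_of_le (mul_pos hA0 hε) hA))) hA hε1
    (fun v hv => (mem_filter.1 hv).2)
  set D : ℝ := (Set.ncard {B | (G.reducedGraph ε δ Q).Adj A B} : ℝ)
  have hM0 : (0 : ℝ) < m + 1 := by positivity
  refine le_of_mul_le_mul_right ?_ hM0
  have hkM : k * (m + 1) ≤ n + ρ * n := by linarith
  have hρn : ρ * n ≤ n := mul_le_of_le_one_left hn0 hρ1
  have hNM : N * (m + 1) ≤ n + ρ * n := (mul_le_mul_of_nonneg_right hNk hM0.le).trans hkM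
  have hNM' : n / 2 ≤ N * (m + 1) := by
    have h1 : k / 2 ≤ N := by nlinarith
    have := mul_le_mul_of_nonneg_right h1 hM0.le
    linarith
  have hminM : min z (b * N) * (m + 1) ≤ min ((1 - ε) * m * z) (b * n) + (ε * n + ρ * n) := by
    rw [← sub_le_iff_le_add]
    refine le_min ?_ ?_
    · have h1 : min z (b * N) * (m + 1) ≤ z * (m + 1) :=
        mul_le_mul_of_nonneg_right (min_le_left _ _) hM0.le
      have h2 : z * m ≤ n := le_trans (mul_le_mul_of_nonneg_right (hzN.trans hNk)
        (Nat.cast_nonneg m)) hkm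
      have h3 := mul_le_mul_of_nonneg_left h2 hε.le
      linarith
    · have h1 : min z (b * N) * (m + 1) ≤ b * N * (m + 1) :=
        mul_le_mul_of_nonneg_right (min_le_right _ _) hM0.le
      have h2 : b * (N * (m + 1)) ≤ b * (n + ρ * n) := mul_le_mul_of_nonneg_left hNM hb.le
      have h3 : b * (ρ * n) ≤ ρ * n := mul_le_of_le_one_left (by positivity) (by linarith)
      have h4 : 0 ≤ ε * n := by positivity
      linarith
  have h1 : a / b * (min z (b * N) * (m + 1))
      ≤ a / b * min ((1 - ε) * m * z) (b * n) + (ε * n + ρ * n) := by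
    refine (mul_le_mul_of_nonneg_left hminM hab0).trans ?_
    rw [mul_add]
    gcongr
    exact mul_le_of_le_one_left (by positivity) hab1'
  have h2 : (1 - a - b) * (N * (m + 1)) ≤ (1 - a - b) * n + ρ * n := by
    refine (mul_le_mul_of_nonneg_left hNM (by linarith)).trans ?_
    have : (1 - a - b) * (ρ * n) ≤ ρ * n := mul_le_of_le_one_left (by positivity) (by linarith)
    linarith
  have h3 : (2 * θ * k + 1) * (m + 1) ≤ (2 * θ + ρ) * (2 * n) := by
    calc (2 * θ * k + 1) * (m + 1) ≤ (2 * θ * k + ρ * k) * (m + 1) := by gcongr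
      _ = (2 * θ + ρ) * (k * (m + 1)) := by ring
      _ ≤ _ := mul_le_mul_of_nonneg_left (by linarith) (by linarith)
  have h4 : 2 * (δ + 2 * ε + 4 * θ + 5 * ρ) * (n / 2)
      ≤ 2 * (δ + 2 * ε + 4 * θ + 5 * ρ) * (N * (m + 1)) :=
    mul_le_mul_of_nonneg_left hNM' (by positivity)
  linarith

/-! ### From fractional clique tilings to `H`-tilings -/

section Rounding

/-- Rotation of the classes other than `none`. -/
def rotate {s : ℕ} [NeZero s] (k : Fin s) (j : Option (Fin s)) : Option (Fin s) := j.map (· + k)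

lemma rotate_injective {s : ℕ} [NeZero s] (k : Fin s) : Function.Injective (rotate k) :=
  Option.map_injective (add_left_injective k)

/-- Over all `s` rotations a vertex of colour `none` always stays in the neck, while any other
vertex visits each of the remaining positions exactly once. -/
lemma sum_card_rotate {W κ : Type*} [Fintype W] [DecidableEq κ] {s : ℕ} [NeZero s]
    (col : W → Option (Fin s)) (c : Option (Fin s) → κ) (A : κ) :
    ∑ k, (#{w | c (rotate k (col w)) = A} : ℝ) =
      s * #{w | col w = none} * (if c none = A then 1 else 0) +
      (Fintype.card W - #{w | col w = none}) * ∑ j, (if c (some j) = A then 1 else 0) := by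
  have hw : ∀ w, ∑ k, (if c (rotate k (col w)) = A then (1 : ℝ) else 0) =
      (if col w = none then 1 else 0) * (s * (if c none = A then 1 else 0)) +
      (1 - if col w = none then 1 else 0) * ∑ j, (if c (some j) = A then 1 else 0) := by
    intro w
    cases h : col w with
    | none =>
      by_cases hA : c none = A <;> simp [rotate, hA]
    | some j =>
      simp only [rotate, Option.map_some, reduceCtorEq, if_false, zero_mul, zero_add, sub_zero,
        one_mul]
      exact Fintype.sum_equiv (Equiv.addLeft j) _ _ fun k => rfl
  have h1 : ∀ k, (#{w | c (rotate k (col w)) = A} : ℝ) =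
      ∑ w, if c (rotate k (col w)) = A then 1 else 0 := fun k => by simp
  have h2 : ∑ w, (if col w = none then (1 : ℝ) else 0) = #{w | col w = none} := by simp
  simp_rw [h1]
  rw [sum_comm, sum_congr rfl fun w _ => hw w, sum_add_distrib, ← sum_mul, ← sum_mul,
    sum_sub_distrib, h2]
  simp only [sum_const, card_univ, nsmul_eq_mul, mul_one]
  ring

/-- A fractional tiling of a reduced graph can be turned into an `H`-tiling. -/
theorem exists_tiling_of_fractional_tiling {W V κ : Type*} [Fintype W] [Nonempty W] [Fintype V]
    [Fintype κ] [DecidableEq κ] {H : SimpleGraph W} {G : SimpleGraph V} [DecidableRel G.Adj]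
    {s : ℕ} [NeZero s] (col : H.Coloring (Option (Fin s))) {x γ ε δ β a b : ℝ}
    (hx0 : 0 ≤ x) (hx1 : x ≤ 1) (hγ0 : 0 ≤ γ) (hγ1 : γ ≤ 1) (hβ0 : 0 < β) (hβ1 : β ≤ 1)
    (hβ : β ≤ δ - ε) (hε : 0 < ε)
    (hεγ : (Fintype.card W + 1) * ε ≤ β ^ Fintype.card W * γ)
    (ha : a = x * #{w | col w = none} / Fintype.card W)
    (hb : b = (Fintype.card W - x * #{w | col w = none}) / (s * Fintype.card W))
    {A : κ → Finset V} (hA : Pairwise (Function.onFun Disjoint A)) {m : ℕ}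
    (hm : ∀ k, m ≤ #(A k)) (hmε : (Fintype.card W : ℝ) ≤ m * ε) (R : SimpleGraph κ)
    (hR : ∀ k l, R.Adj k l → G.IsUniform ε (A k) (A l) ∧ δ ≤ (G.edgeDensity (A k) (A l) : ℝ))
    {f : (Option (Fin s) → κ) → ℝ} (hf0 : ∀ c, 0 ≤ f c)
    (hf : ∀ c, f c ≠ 0 → ∀ i j, i ≠ j → R.Adj (c i) (c j))
    (hload : ∀ k, ∑ c, f c * ∑ j, (if c j = k then bottleWeight none a b j else 0) ≤ 1) :
    ∃ T : Set G.Subgraph, H.IsTiling G T ∧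
      x * (1 - γ) * m * ∑ c, f c - Fintype.card W * s * (Fintype.card κ : ℝ) ^ (s + 1)
        ≤ (coveredVerts T).ncard := by
  classical
  set h : ℝ := (Fintype.card W : ℝ) with hh
  set σ : ℝ := (#{w | col w = none} : ℝ) with hσ
  have hhpos : 0 < h := by rw [hh]; exact_mod_cast Fintype.card_pos
  have hspos : (0 : ℝ) < s := by exact_mod_cast Nat.pos_of_ne_zero (NeZero.ne s)
  have hσh : σ ≤ h := Nat.cast_le.2 (card_le_univ _)
  -- A clique of weight one receives `y` copies for each rotation. These cover `h s y = x (1 - γ) m`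
  -- vertices and load the neck by `(1 - γ) m a` and any other position by at most `(1 - γ) m b`,
  -- because `x (h - σ) ≤ h - x σ`.
  set y : ℝ := x * (1 - γ) * m / (h * s) with hy
  have hy0 : 0 ≤ y := div_nonneg (mul_nonneg (mul_nonneg hx0 (by linarith)) (Nat.cast_nonneg _))
    (by positivity)
  set cl : (Option (Fin s) → κ) × Fin s → W → κ := fun t w => t.1 (rotate t.2 (col w)) with hcl
  set q : (Option (Fin s) → κ) × Fin s → ℕ := fun t => ⌊f t.1 * y⌋₊ with hq
  have hcard : ∀ c k, ∑ i, (#{w | cl (c, i) w = k} : ℝ) * (x / (h * s)) ≤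
      ∑ j, (if c j = k then bottleWeight none a b j else 0) := by
    intro c k
    rw [← sum_mul, sum_card_rotate, Fintype.sum_option]
    have e1 : (if c none = k then bottleWeight (none : Option (Fin s)) a b none else 0)
        = a * (if c none = k then 1 else 0) := by simp [bottleWeight]
    have e2 : ∑ j : Fin s, (if c (some j) = k then
        bottleWeight (none : Option (Fin s)) a b (some j) else 0)
        = b * ∑ j : Fin s, (if c (some j) = k then 1 else 0) := by
      rw [mul_sum]
      exact sum_congr rfl fun j _ => by simp [bottleWeight]
    rw [e1, e2]
    set S : ℝ := ∑ j : Fin s, (if c (some j) = k then (1 : ℝ) else 0)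
    have hS : 0 ≤ S := sum_nonneg fun j _ => by split_ifs <;> norm_num
    have e3 : (s * σ * (if c none = k then 1 else 0) + (h - σ) * S) * (x / (h * s))
        = a * (if c none = k then 1 else 0) + x * (h - σ) / (s * h) * S := by
      rw [ha]; field_simp
    rw [e3, hb]
    gcongr
    nlinarith
  have hqload : ∀ k, (∑ t, q t * #{w | cl t w = k} : ℝ) ≤ (1 - γ) * #(A k) := by
    intro k
    calc (∑ t, q t * #{w | cl t w = k} : ℝ)
        ≤ ∑ t : (Option (Fin s) → κ) × Fin s, f t.1 * y * #{w | cl t w = k} :=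
          sum_le_sum fun t _ => mul_le_mul_of_nonneg_right
            (Nat.floor_le (mul_nonneg (hf0 _) hy0)) (Nat.cast_nonneg _)
      _ = (1 - γ) * m * ∑ c, f c * ∑ i, (#{w | cl (c, i) w = k} : ℝ) * (x / (h * s)) := by
          rw [Fintype.sum_prod_type, mul_sum]
          refine sum_congr rfl fun c _ => ?_
          rw [mul_sum, mul_sum]
          refine sum_congr rfl fun i _ => ?_
          rw [hy]; ring
      _ ≤ (1 - γ) * m * 1 := by
          refine mul_le_mul_of_nonneg_left (le_trans (sum_le_sum fun c _ => ?_) (hload k))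
            (mul_nonneg (by linarith) (Nat.cast_nonneg _))
          exact mul_le_mul_of_nonneg_left (hcard c k) (hf0 c)
      _ ≤ (1 - γ) * #(A k) := by
          rw [mul_one]
          exact mul_le_mul_of_nonneg_left (Nat.cast_le.2 (hm k)) (by linarith)
  obtain ⟨S, hScard, hSdisj, -⟩ := exists_disjoint_copies (G := G) (H := H) hA cl (γ := γ) q
    (by
      rintro ⟨c, i⟩ ht U hU hUcard
      have hfc : f c ≠ 0 := by
        rintro h0
        simp [hq, h0] at ht
      have hadj : ∀ w w', H.Adj w w' → R.Adj (cl (c, i) w) (cl (c, i) w') := fun w w' hww' =>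
        hf c hfc _ _ fun heq => col.valid hww' (rotate_injective i heq)
      exact exists_copy_of_isUniform H hβ0 hβ1 hβ hγ0 hε hεγ (fun w => hU (cl (c, i) w))
        (fun w => hUcard _) (fun w => hmε.trans (mul_le_mul_of_nonneg_right
          (Nat.cast_le.2 (hm _)) hε.le)) (fun w w' hww' => (hR _ _ (hadj w w' hww')).1)
        (fun w w' hww' => (hR _ _ (hadj w w' hww')).2))
    (by convert hqload)
  obtain ⟨T, hT, hTcard⟩ := exists_tiling_of_disjoint_copies S hSdisj
  refine ⟨T, hT, ?_⟩
  rw [hTcard, hScard]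
  push_cast
  -- Rounding down costs at most one copy for each pair of a map into the clusters and a rotation.
  have h1 : ∑ t : (Option (Fin s) → κ) × Fin s, (f t.1 * y - 1) ≤ ∑ t, (q t : ℝ) :=
    sum_le_sum fun t _ => (Nat.sub_one_lt_floor _).le
  have h2 : ∑ t : (Option (Fin s) → κ) × Fin s, (f t.1 * y - 1)
      = s * y * ∑ c, f c - s * (Fintype.card κ : ℝ) ^ (s + 1) := by
    rw [Fintype.sum_prod_type]
    simp only [sum_const, card_univ, Fintype.card_fin, nsmul_eq_mul]
    rw [← mul_sum, sum_sub_distrib, ← sum_mul]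
    simp
    ring
  calc x * (1 - γ) * m * ∑ c, f c - h * s * (Fintype.card κ : ℝ) ^ (s + 1)
      = h * (s * y * ∑ c, f c - s * (Fintype.card κ : ℝ) ^ (s + 1)) := by
        rw [hy]; field_simp
    _ ≤ h * ∑ t, (q t : ℝ) := mul_le_mul_of_nonneg_left (h2 ▸ h1) hhpos.le

end Rounding

/-! ### Choice of constants and application of the regularity lemma -/

/-- The choice of the density `ω` and the regularity parameter `ε`. -/
lemma exists_param {ζ a b : ℝ} (hζ0 : 0 < ζ) (hζ1 : ζ ≤ 1 / 2) (ha : 0 < a) (hb : 0 < b)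
    (hab1 : a + b ≤ 1) (h : ℕ) :
    ∃ ω ε : ℝ, 0 < ω ∧ ω ≤ 1 / 2 ∧ ω ≤ ζ ∧ 0 < ε ∧ ε ≤ 1 ∧ ε ≤ ω ^ 2 ∧ ω / 2 ≤ ω - ε ∧
      2 * (ω + 2 * ε + 4 * ω + 5 * ω) ≤ ζ * (a * b) ∧
      (h + 1) * ε ≤ (ω / 2) ^ h * ζ := by
  have hab : a * b ≤ 1 := by nlinarith
  have hab0 : 0 < a * b := mul_pos ha hb
  -- With `ε ≤ ω / 2` the degree loss `20 ω + 4 ε` is below `40 ω = ζ a b`.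
  set ω := ζ * (a * b) / 40 with hω
  have hω0 : 0 < ω := by positivity
  have hωζ : ω ≤ ζ / 40 := by
    rw [hω]; gcongr; exact mul_le_of_le_one_right hζ0.le hab
  have hp : 0 < (ω / 2) ^ h * ζ / (h + 1) := by positivity
  refine ⟨ω, min (ω ^ 2 / 2) ((ω / 2) ^ h * ζ / (h + 1)), hω0, by linarith, by linarith,
    lt_min (by positivity) hp, ?_, ?_, ?_, ?_, ?_⟩
  · exact (min_le_left _ _).trans (by nlinarith)
  · exact (min_le_left _ _).trans (by nlinarith)
  · have : min (ω ^ 2 / 2) ((ω / 2) ^ h * ζ / (h + 1)) ≤ ω ^ 2 / 2 := min_le_left _ _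
    nlinarith
  · have h1 : min (ω ^ 2 / 2) ((ω / 2) ^ h * ζ / (h + 1)) ≤ ω ^ 2 / 2 := min_le_left _ _
    have h2 : ω ^ 2 ≤ ω := by nlinarith
    have h3 : ζ * (a * b) = 40 * ω := by rw [hω]; ring
    rw [h3]
    linarith
  · calc ((h : ℝ) + 1) * min (ω ^ 2 / 2) ((ω / 2) ^ h * ζ / (h + 1))
        ≤ (h + 1) * ((ω / 2) ^ h * ζ / (h + 1)) := by gcongr; exact min_le_right _ _
      _ = _ := by field_simp

/-- Tilings in graphs in which every set of vertices contains a vertex of large degree. -/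
theorem exists_tiling_of_degree_property {W : Type u} [Fintype W] [Nonempty W]
    {H : SimpleGraph W} {s : ℕ} [NeZero s] (col : H.Coloring (Option (Fin s)))
    (hσ0 : 0 < #{w | col w = none}) (hσ : (s + 1) * #{w | col w = none} ≤ Fintype.card W)
    {x η a b : ℝ} (hx0 : 0 < x) (hx1 : x < 1) (hη : 0 < η)
    (ha : a = x * #{w | col w = none} / Fintype.card W)
    (hb : b = (Fintype.card W - x * #{w | col w = none}) / (s * Fintype.card W)) :
    ∃ n₀ : ℕ, ∀ n : ℕ, n₀ ≤ n → 1 ≤ b * n ∧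
      ∀ (V : Type v) [Fintype V] (G : SimpleGraph V) [DecidableRel G.Adj],
        Fintype.card V = n →
        (∀ S : Finset V, S.Nonempty → ∃ v ∈ S, (1 - a - b) * n
          + a / b * min (#S : ℝ) (b * n) - 1 ≤ G.degree v) →
        ∃ T : Set G.Subgraph, H.IsTiling G T ∧ (x - η) * n ≤ (coveredVerts T).ncard := by
  classical
  set h : ℝ := (Fintype.card W : ℝ) with hh
  set σ : ℝ := (#{w | col w = none} : ℝ) with hσdef
  have hhpos : 0 < h := by rw [hh]; exact_mod_cast Fintype.card_pos
  have hspos : (0 : ℝ) < s := by exact_mod_cast Nat.pos_of_ne_zero (NeZero.ne s)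
  have hs1 : (1 : ℝ) ≤ s := by exact_mod_cast Nat.one_le_iff_ne_zero.2 (NeZero.ne s)
  have hσpos : 0 < σ := by rw [hσdef]; exact_mod_cast hσ0
  have hσh : (s + 1) * σ ≤ h := by rw [hσdef, hh]; exact_mod_cast hσ
  have ha0 : 0 < a := by rw [ha]; positivity
  have hxσ : x * ((s + 1) * σ) < h := by
    have h1 : x * ((s + 1) * σ) ≤ x * h := mul_le_mul_of_nonneg_left hσh hx0.le
    nlinarith
  -- The strictness required by the exchange argument comes from `x < 1`; for `x = 1` and equal
  -- colour classes `a` and `b` would coincide.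
  have hab : a < b := by
    rw [ha, hb, div_lt_div_iff₀ hhpos (by positivity)]
    have := mul_lt_mul_of_pos_right hxσ hhpos
    nlinarith
  have hb0 : 0 < b := ha0.trans hab
  have hsum1 : a + s * b = 1 := by
    rw [ha, hb]; field_simp; ring
  have hab1 : a + b ≤ 1 := by nlinarith
  have hsum : ∑ j, bottleWeight (none : Option (Fin s)) a b j = 1 := by
    rw [Fintype.sum_option]
    simpa [bottleWeight] using hsum1
  -- A factor `1 - ζ` is lost four times: to unused room in clusters, the fractional tiling,
  -- discarded parts, and the division of `n` into parts. Rounding costs a further `ζ n`.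
  set ζ : ℝ := min (1 / 2) (η / 5) with hζ
  have hζ0 : 0 < ζ := lt_min (by norm_num) (by positivity)
  have hζ1 : ζ ≤ 1 / 2 := min_le_left _ _
  have hζη : 5 * ζ ≤ η := by
    have : ζ ≤ η / 5 := min_le_right _ _
    linarith
  obtain ⟨ω, ε, hω0, hω1, hωζ, hε0, hε1, hεω, hβ, hεab, hεγ⟩ :=
    exists_param hζ0 hζ1 ha0 hb0 hab1 (Fintype.card W)
  set l : ℕ := ⌈1 / ω⌉₊ with hl
  set K : ℕ := SzemerediRegularity.bound ε l with hK
  have hev : ∀ L c : ℝ, 0 < c → ∀ᶠ n : ℕ in Filter.atTop, L ≤ c * n := fun L c hc =>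
    (tendsto_natCast_atTop_atTop.const_mul_atTop hc).eventually_ge_atTop L
  obtain ⟨n₀, hn₀⟩ := Filter.eventually_atTop.1
    ((hev 1 b hb0).and ((hev l 1 one_pos).and ((hev K ω hω0).and
      ((hev (h * s * (K : ℝ) ^ (s + 1)) ζ hζ0).and (hev ((h / ε + 1) * K) 1 one_pos)))))
  refine ⟨n₀, fun n hn => ?_⟩
  obtain ⟨hn1, hn2, hn3, hn4, hn5⟩ := hn₀ n hn
  refine ⟨hn1, fun V _ G _ hcard hG => ?_⟩
  rw [one_mul] at hn2 hn5
  obtain ⟨P, hPeq, hPl, hPK, hPuni⟩ := szemeredi_regularity (G := G) hε0 (l := l)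
    (by rw [hcard]; exact_mod_cast hn2)
  set k : ℝ := (#P.parts : ℝ) with hk
  have hkK : k ≤ K := Nat.cast_le.2 hPK
  have hωl : 1 / ω ≤ k := (Nat.le_ceil _).trans (Nat.cast_le.2 hPl)
  have hωk : 1 ≤ ω * k := by rwa [div_le_iff₀' hω0] at hωl
  have hk0 : 0 < k := lt_of_lt_of_le (by positivity) hωl
  have hkn : k ≤ ω * n := hkK.trans hn3
  set m : ℕ := n / #P.parts with hm
  have hmle : ∀ B ∈ P.parts, m ≤ #B := fun B hB => by
    have := hPeq.average_le_card_part hB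
    rwa [card_univ, hcard] at this
  have hmge : ∀ B ∈ P.parts, #B ≤ m + 1 := fun B hB => by
    have := hPeq.card_part_le_average_add_one hB
    rwa [card_univ, hcard] at this
  have hnk : (n : ℝ) ≤ k * (m + 1) := by
    have h1 : n < #P.parts * (n / #P.parts + 1) := by
      have := Nat.lt_mul_div_succ n (show 0 < #P.parts by rw [hk] at hk0; exact_mod_cast hk0)
      exact this
    rw [hk]
    exact_mod_cast h1.le
  have hmε : h ≤ m * ε := by
    have h1 : (h / ε + 1) * k ≤ (m + 1) * k := by
      calc (h / ε + 1) * k ≤ (h / ε + 1) * K := by gcongr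
        _ ≤ n := hn5
        _ ≤ (m + 1) * k := by linarith
    have h2 := le_of_mul_le_mul_right h1 hk0
    rw [← div_le_iff₀ hε0]
    linarith
  set Q := goodParts G P ε ω with hQ
  have hQP : Q ⊆ P.parts := filter_subset _ _
  have hQcard : (1 - ω) * k ≤ #Q := le_card_goodParts hε0.le hω0 hεω hPuni
  set R := G.reducedGraph ε ω Q with hR
  have hprop := reducedGraph_degree_property (G := G) (P := P) (a := a) (b := b) (ε := ε)
    (δ := ω) (θ := ω) (ρ := ω) ha0 hab hab1 hε0 hε1 hω0.le hω0.le hω1 (by linarith) hmle hmge hωk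
    (by rw [hcard]; exact hkn) hQP hQcard (fun A hA => (mem_filter.1 hA).2)
    (by rw [hcard]; exact hG)
  -- The error `ζ a b` makes the relative loss in the fractional tiling exactly `ζ`.
  obtain ⟨f, hf0, hfadj, hfload, hfsum⟩ := exists_fractional_tiling (V := Q) (G := R)
    (o := (none : Option (Fin s))) (a := a) (b := b) (ε := ζ * (a * b)) ha0 hab hsum
    ⟨some 0, by simp⟩ (by positivity) (by
      intro Z hZ
      obtain ⟨A, hAZ, hA⟩ := hprop Z hZ
      refine ⟨A, hAZ, ?_⟩
      rw [Fintype.card_coe]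
      have h1 : Set.ncard {B | R.Adj A B} + #{B | ¬R.Adj A B} = #Q := by
        rw [Set.ncard_eq_toFinset_card', ← Fintype.card_coe Q, ← card_univ,
          ← card_filter_add_card_filter_not (s := univ) (fun B => R.Adj A B)]
        congr 2
        ext B; simp
      have h2 : (Set.ncard {B | R.Adj A B} : ℝ) + #{B | ¬R.Adj A B} = #Q := by
        exact_mod_cast h1
      have h3 : 2 * (ω + 2 * ε + 4 * ω + 5 * ω) * #Q ≤ ζ * (a * b) * #Q :=
        mul_le_mul_of_nonneg_right hεab (Nat.cast_nonneg _)
      linarith)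
  obtain ⟨T, hT, hTcard⟩ := exists_tiling_of_fractional_tiling (H := H) (G := G) col
    (x := x) (γ := ζ) (ε := ε) (δ := ω) (β := ω / 2) hx0.le hx1.le hζ0.le (by linarith)
    (by positivity) (by linarith) hβ hε0 hεγ ha hb (A := fun A : Q => A.1)
    (fun A B hne => P.disjoint (hQP A.2) (hQP B.2) fun h => hne (Subtype.ext h))
    (fun A => hmle _ (hQP A.2)) hmε R (fun A B hAB => hAB.2) hf0 hfadj hfload
  refine ⟨T, hT, le_trans ?_ hTcard⟩
  rw [Fintype.card_coe] at hfsum ⊢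
  have hsimp : 1 - ζ * (a * b) / (a * b) = 1 - ζ := by field_simp
  rw [hsimp] at hfsum
  have hζ' : 0 ≤ 1 - ζ := by linarith
  have hNk : (#Q : ℝ) ≤ K := le_trans (Nat.cast_le.2 (card_le_card hQP)) hkK
  have herr : h * s * (#Q : ℝ) ^ (s + 1) ≤ ζ * n := le_trans (by gcongr) hn4
  have hnn : (0 : ℝ) ≤ n := Nat.cast_nonneg _
  have hfsum' : (1 - ζ) * ((1 - ζ) * k) ≤ ∑ c, f c := by
    refine le_trans ?_ hfsum
    rw [mul_comm (#Q : ℝ)]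
    refine mul_le_mul_of_nonneg_left (le_trans ?_ hQcard) hζ'
    gcongr
  have hmk : (1 - ζ) * n ≤ m * k := by
    have : k ≤ ζ * n := hkn.trans (by gcongr)
    linarith
  have hmain : x * ((1 - ζ) ^ 3 * ((1 - ζ) * n)) ≤ x * (1 - ζ) * m * ∑ c, f c := by
    calc x * ((1 - ζ) ^ 3 * ((1 - ζ) * n)) ≤ x * ((1 - ζ) ^ 3 * (m * k)) := by gcongr
      _ = x * (1 - ζ) * m * ((1 - ζ) * ((1 - ζ) * k)) := by ring
      _ ≤ _ := by gcongr
  have hbern : 1 - 4 * ζ ≤ (1 - ζ) ^ 4 := by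
    have := one_add_mul_le_pow (show (-2 : ℝ) ≤ -ζ by linarith) 4
    push_cast at this
    linarith [show (1 + -ζ) ^ 4 = (1 - ζ) ^ 4 by ring]
  have h1 : x * ((1 - 4 * ζ) * n) ≤ x * ((1 - ζ) ^ 3 * ((1 - ζ) * n)) := by
    have : (1 - ζ) ^ 3 * ((1 - ζ) * n) = (1 - ζ) ^ 4 * n := by ring
    rw [this]
    gcongr
  have h2 : x * (4 * ζ * n) ≤ 4 * ζ * n := mul_le_of_le_one_left (by positivity) hx1.le
  have h3 : 5 * ζ * n ≤ η * n := mul_le_mul_of_nonneg_right hζη hnn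
  linarith

/-! ### Degree sequences, optimal colourings and the main theorem -/

/-- Every set of vertices contains a vertex whose degree is at least as large as the degree
sequence predicts. -/
lemma IsDegreeSequence.exists_le_degree {V : Type*} [Fintype V] {G : SimpleGraph V}
    [DecidableRel G.Adj] {n : ℕ} {d : Fin n → ℕ} (hd : G.IsDegreeSequence d) {a b : ℝ}
    (ha : 0 < a) (hab : a ≤ b) (hbn : 1 ≤ b * n)
    (hdeg : ∀ (i : ℕ) (hi : i < n), ((i : ℝ) + 1) ≤ b * n →
      (1 - a - b) * n + a / b * ((i : ℝ) + 1) ≤ d ⟨i, hi⟩)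
    (S : Finset V) (hS : S.Nonempty) :
    ∃ v ∈ S, (1 - a - b) * n + a / b * min (#S : ℝ) (b * n) - 1 ≤ G.degree v := by
  classical
  obtain ⟨hmono, e, he⟩ := hd
  have hb : 0 < b := ha.trans_le hab
  set I : Finset (Fin n) := S.map e.symm.toEmbedding with hI
  have hIne : I.Nonempty := hS.map
  have hIcard : #I = #S := card_map _
  set j := I.max' hIne with hj
  have hjI : j ∈ I := I.max'_mem hIne
  have hjS : #S ≤ j + 1 := by
    rw [← hIcard]
    calc #I ≤ #(Finset.Iic j) := card_le_card fun i hi => Finset.mem_Iic.2 (I.le_max' i hi)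
      _ = j + 1 := Fin.card_Iic j
  obtain ⟨v, hvS, hv⟩ := mem_map.1 hjI
  have hvj : e j = v := by rw [← hv]; simp
  refine ⟨v, hvS, ?_⟩
  rw [← hvj, ← he j]
  -- The last vertex of `S` in the degree order has one-based position at least `#S`, hence at least
  -- `i₀`. The floor keeps `i₀` in the range of the hypothesis and loses less than one, which the `-
  -- 1` absorbs as `a / b ≤ 1`; `hbn` ensures `i₀ ≥ 1`.
  set i₀ := min #S ⌊b * n⌋₊ with hi₀
  have hi₀1 : 1 ≤ i₀ := le_min hS.card_pos (Nat.one_le_floor_iff _ |>.2 hbn)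
  obtain ⟨i, hi⟩ : ∃ i, i₀ = i + 1 := ⟨i₀ - 1, by omega⟩
  have hij : i ≤ j := by
    have : i₀ ≤ #S := min_le_left _ _
    omega
  have hin : i < n := lt_of_le_of_lt hij j.2
  have hib : (i : ℝ) + 1 ≤ b * n := by
    have h1 : i + 1 ≤ ⌊b * n⌋₊ := hi ▸ min_le_right _ _
    have h2 := (Nat.le_floor_iff (by linarith)).1 h1
    exact_mod_cast h2
  have h1 := hdeg i hin hib
  have h2 : (d ⟨i, hin⟩ : ℝ) ≤ d j := Nat.cast_le.2 (hmono (show (⟨i, hin⟩ : Fin n) ≤ j from hij))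
  have h3 : min (#S : ℝ) (b * n) - 1 ≤ (i : ℝ) + 1 := by
    have e1 : ((i : ℝ) + 1) = min (#S : ℝ) (⌊b * n⌋₊ : ℝ) := by
      rw [← Nat.cast_min, ← hi₀, hi]; push_cast; ring
    rw [e1]
    refine le_min ?_ ?_
    · linarith [min_le_left (#S : ℝ) (b * n)]
    · linarith [min_le_right (#S : ℝ) (b * n), Nat.lt_floor_add_one (b * n)]
  have h4 : a / b * (min (#S : ℝ) (b * n) - 1) ≤ a / b * ((i : ℝ) + 1) :=
    mul_le_mul_of_nonneg_left h3 (div_pos ha hb).le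
  have h5 : a / b ≤ 1 := (div_le_one hb).2 hab
  linarith

/-- An optimal colouring whose class `none` is as small as possible. -/
lemma exists_coloring_smallestClass {W : Type*} [Fintype W] (H : SimpleGraph W) {s : ℕ}
    (hχ : H.chromaticNumber = ((s + 1 : ℕ) : ℕ∞)) :
    ∃ col : H.Coloring (Option (Fin s)), #{w | col w = none} = H.smallestClass ∧
      0 < H.smallestClass ∧ (s + 1) * H.smallestClass ≤ Fintype.card W := by
  classical
  have hchi : H.chi = s + 1 := by simp [chi, hχ]
  have hcol : H.Colorable (s + 1) := chromaticNumber_le_iff_colorable.1 hχ.le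
  have hle : ∀ (C : H.Coloring (Fin H.chi)) c, H.smallestClass ≤ (C.colorClass c).ncard :=
    fun C c => Nat.sInf_le ⟨C, c, rfl⟩
  obtain ⟨C, c, hCc⟩ : ∃ (C : H.Coloring (Fin H.chi)) (c : Fin H.chi),
      H.smallestClass = (C.colorClass c).ncard := by
    have hne : {k : ℕ | ∃ (C : H.Coloring (Fin H.chi)) (c : Fin H.chi),
        k = (C.colorClass c).ncard}.Nonempty := by
      rw [← hchi] at hcol
      exact ⟨_, hcol.some, ⟨0, by omega⟩, rfl⟩
    exact Nat.sInf_mem hne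
  -- A colouring with the minimum number of colours uses all of them, so the smallest class is
  -- nonempty.
  have hsurj : Function.Surjective C := by
    have h1 := (chromaticNumber_eq_iff_forall_surjective (n := H.chi)
      (by rw [hchi]; exact hcol)).1 (by rw [hχ, hchi])
    exact h1 C
  have hncard : ∀ d, (C.colorClass d).ncard = #{w | C w = d} := fun d => by
    rw [← Set.ncard_coe_finset]
    congr 1
    ext w
    change C w = d ↔ _
    simp
  have hsum : ∑ d, #{w | C w = d} = Fintype.card W :=
    (card_eq_sum_card_fiberwise (f := C) (t := univ) fun w _ => by simp).symm
  obtain ⟨e, he⟩ : ∃ e : Fin H.chi ≃ Option (Fin s), e c = none :=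
    ⟨(finCongr hchi).trans (finSuccEquiv' (finCongr hchi c)), by simp⟩
  refine ⟨Coloring.mk (fun w => e (C w)) fun h heq => C.valid h (e.injective heq), ?_, ?_, ?_⟩
  · rw [hCc, hncard]
    congr 1
    ext w
    simp only [mem_filter, mem_univ, true_and]
    change e (C w) = none ↔ C w = c
    rw [← he, e.apply_eq_iff_eq]
  · rw [hCc, hncard]
    obtain ⟨w, hw⟩ := hsurj c
    exact card_pos.2 ⟨w, by simp [hw]⟩
  · calc (s + 1) * H.smallestClass = ∑ _d : Fin H.chi, H.smallestClass := by simp [hchi]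
      _ ≤ ∑ d, #{w | C w = d} := sum_le_sum fun d _ => (hle C d).trans (hncard d).le
      _ = _ := hsum

end SimpleGraph

theorem theorem1p5 {W : Type u} [Fintype W] (H : SimpleGraph W) (r : ℕ)
    (hχ : H.chromaticNumber = (r : ℕ∞)) (hr : 2 ≤ r)
    (x : ℝ) (hx0 : 0 < x) (hx1 : x < 1) (η : ℝ) (hη : 0 < η)
    (h σ : ℝ) (hh : h = (Fintype.card W : ℝ)) (hσ : σ = (H.smallestClass : ℝ)) :
    ∃ n₀ : ℕ, ∀ n : ℕ, n₀ ≤ n →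
      ∀ (V : Type v) [Fintype V] (G : SimpleGraph V) [DecidableRel G.Adj] (d : Fin n → ℕ),
        G.IsDegreeSequence d →
        (∀ (i : ℕ) (hi : i < n), ((i : ℝ) + 1) ≤ (h - x * σ) / (((r : ℝ) - 1) * h) * (n : ℝ) →
          (H.komlosThreshold x - x * σ / h) * (n : ℝ)
              + (((r : ℝ) - 1) * x * σ / (h - x * σ)) * ((i : ℝ) + 1) ≤ (d ⟨i, hi⟩ : ℝ)) →
        ∃ T : Set G.Subgraph, H.IsTiling G T ∧
          (x - η) * (n : ℝ) ≤ ((SimpleGraph.coveredVerts T).ncard : ℝ) := by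
  obtain ⟨s, rfl⟩ : ∃ s, r = s + 1 := ⟨r - 1, by omega⟩
  have hs : s ≠ 0 := by omega
  have : NeZero s := ⟨hs⟩
  obtain ⟨col, hcol, hσ0, hσle⟩ := H.exists_coloring_smallestClass hχ
  have hcard0 : 0 < Fintype.card W := by
    have : 0 < (s + 1) * H.smallestClass := by positivity
    omega
  have : Nonempty W := Fintype.card_pos_iff.1 hcard0
  have hspos : (0 : ℝ) < s := by exact_mod_cast Nat.pos_of_ne_zero hs
  have hhpos : 0 < h := by rw [hh]; exact_mod_cast hcard0
  have hσpos : 0 < σ := by rw [hσ]; exact_mod_cast hσ0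
  have hσh : (s + 1) * σ ≤ h := by rw [hσ, hh]; exact_mod_cast hσle
  have hxσ : x * σ < σ := mul_lt_of_lt_one_left hσpos hx1
  have hden : 0 < h - x * σ := by nlinarith
  have hden' : 0 < h - σ := by nlinarith
  set a : ℝ := x * σ / h with ha
  set b : ℝ := (h - x * σ) / (s * h) with hb
  have ha0 : 0 < a := by positivity
  have hab : a ≤ b := by
    rw [ha, hb, div_le_div_iff₀ hhpos (by positivity)]
    nlinarith [mul_pos hspos hhpos, mul_pos hx0 hσpos, mul_pos (mul_pos hspos hhpos) hσpos]
  obtain ⟨n₀, hn₀⟩ := SimpleGraph.exists_tiling_of_degree_property.{u, v} col (by rwa [hcol])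
    (by rwa [hcol]) hx0 hx1 hη (a := a) (b := b) (by rw [ha, hcol, hσ, hh])
    (by rw [hb, hcol, hσ, hh])
  refine ⟨n₀, fun n hn V _ G _ d hd hdeg => ?_⟩
  obtain ⟨hbn, hmain⟩ := hn₀ n hn
  have hcardV : Fintype.card V = n := by
    obtain ⟨-, e, -⟩ := hd
    simpa using (Fintype.card_congr e).symm
  have hchi : H.chi = s + 1 := by simp [SimpleGraph.chi, hχ]
  have hb' : (h - x * σ) / ((((s + 1 : ℕ) : ℝ) - 1) * h) = b := by
    rw [hb]; push_cast; ring_nf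
  have hab' : (((s + 1 : ℕ) : ℝ) - 1) * x * σ / (h - x * σ) = a / b := by
    rw [ha, hb]; push_cast; field_simp; ring
  -- The terms in `x h` cancel, leaving `g_H(x) = 1 - b`.
  have hthr : H.komlosThreshold x - x * σ / h = 1 - a - b := by
    rw [SimpleGraph.komlosThreshold, SimpleGraph.chiCr, hchi, ← hh, ← hσ, ha, hb]
    push_cast
    rw [add_sub_cancel_right]
    field_simp
    ring
  rw [hb', hab', hthr] at hdeg
  exact hmain V G hcardV (hd.exists_le_degree ha0 hab hbn hdeg)
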